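/- An instance of Unary Subset-Sum consists of integers $m_1,\dots,m_n$ ($n\ge 0$) and $B$, all written in unary (an integer $z$ is written as a minus sign if $z<0$, followed by $|z|$ ones and a separator; the instance is the word for $B,m_1,\dots,m_n$). The question is whether there is $S\subseteq[n]$ with $\sum_{i\in S}m_i=B$. Let $C=|B|+\sum_{i=1}^n|m_i|+1$, let $A$ be the number of $S\subseteq [n]$ with $\sum_{i\in S}m_i=B$, and let $\mathrm{NextPrime}(k)$ be the least prime larger than $k$. Consider the following algorithm. Start with $c:=0$ and $p:=\mathrm{NextPrime}(C)$. While $c\le n$: if $$\sum_{x=1}^{p-1}x^{-B}\prod_{i=1}^n(1+x^{m_i})\not\equiv 0\pmod p,$$ return True; otherwise set $c:=c+\lfloor\log_2 p\rfloor$ and then $p:=\mathrm{NextPrime}(p)$. When the loop ends, return False. Then the following hold. 1. Unary Subset-Sum is in deterministic logspace: the language of encodings of solvable instances is decided by a deterministic Turing machine with a read-only input tape and finitely many work tapes that halts on every input and visits $O(\log N)$ work cells on inputs of length $N$. 2. The algorithm runs in logspace: there is such a machine, deciding Unary Subset-Sum with $O(\log N)$ work cells, which on the encoding of any instance carries out the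 algorithm. That is, at successive times it passes through configurations representing the successive states of the algorithm: at the head of the while loop it is in a fixed control state and has the current values of $p$ and $c$ stored in binary on two fixed work tapes, and when the algorithm returns a truth value, it halts with that answer. 3. The algorithm is correct: on every instance it terminates; it returns True if and only if there is $S\subseteq[n]$ with $\sum_{i\in S}m_i=B$, and returns False if and only if there is none. 4. For every instance $A\le 2^n$. Whenever the algorithm is at the head of the while loop with values $c$ and $p$, the product of the primes checked so far (the primes $q$ with $C<q<p$) divides $A$, and if $c>n$ this product exceeds $2^n$. 5. There is a constant $d$ such that for all integers $C\ge 1$ and $n\ge 0$ there are at least $n$ primes in $[C,(C+n+1)^d]$. There is also a constant $d$ such that, for every instance, every value taken by $p$ at the head of the while loop is at most $(C+n+1)^d$. -/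

import Mathlib

open Filter

/-! ### Deterministic Turing machines with a read-only input tape -/

/-- A move of a tape head. -/
inductive HeadMove where
  | left
  | stay
  | right

/-- What the input head can see: an end marker or a letter of the input. -/
inductive InputCell (α : Type) where
  | leftEnd
  | letter (a : α)
  | rightEnd

/-- A deterministic Turing machine with a two-way read-only input tape over the alphabet `α` and
finitely many read-write work tapes over a finite alphabet, each infinite to the right.
A state `q` with `verdict q = some b` is a halting state (accepting if `b` is true and
rejecting if `b` is false). In the other states `δ`, applied to the state, to the cell
under the input head and to the cells under the work heads, gives the next state, the move of the
input head, and for each work tape the symbol to be written and the move of its head. -/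
structure OfflineTM (α : Type) where
  /-- states -/
  Q : Type
  /-- names of the work tapes -/
  K : Type
  /-- work alphabet -/
  Γ : Type
  [finQ : Finite Q]
  [finK : Finite K]
  [finΓ : Finite Γ]
  blank : Γ
  start : Q
  verdict : Q → Option Bool
  δ : Q → InputCell α → (K → Γ) → Q × HeadMove × (K → Γ × HeadMove)

namespace OfflineTM

variable {α : Type}

/-- A configuration. Position `0` of the input head is the left end marker, positions
`1, …, |w|` are the letters of the input `w`, position `|w| + 1` is the right end marker. -/
structure Cfg (M : OfflineTM α) where
  state : M.Q
  inputPos : ℕ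
  tape : M.K → ℕ → M.Γ
  head : M.K → ℕ

/-- The content of the input tape at position `i`. -/
def inputCell (w : List α) : ℕ → InputCell α
  | 0 => .leftEnd
  | i + 1 => match w[i]? with
    | some a => .letter a
    | none => .rightEnd

/-- Movement of the input head, which never leaves the two end markers. -/
def moveInput (w : List α) (i : ℕ) : HeadMove → ℕ
  | .left => i - 1
  | .stay => i
  | .right => min (i + 1) (w.length + 1)

/-- Movement of a work head; a move to the left in the leftmost cell `0` has no effect. -/
def moveWork (i : ℕ) : HeadMove → ℕ
  | .left => i - 1
  | .stay => i
  | .right => i + 1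

/-- The initial configuration: blank work tapes. -/
def init (M : OfflineTM α) : M.Cfg where
  state := M.start
  inputPos := 0
  tape := fun _ _ => M.blank
  head := fun _ => 0

/-- One step on input `w`; halting configurations are fixed. -/
def step (M : OfflineTM α) (w : List α) (C : M.Cfg) : M.Cfg :=
  match M.verdict C.state with
  | some _ => C
  | none =>
    let a := M.δ C.state (inputCell w C.inputPos) (fun k => C.tape k (C.head k))
    { state := a.1
      inputPos := moveInput w C.inputPos a.2.1
      tape := fun k => Function.update (C.tape k) (C.head k) (a.2.2 k).1
      head := fun k => moveWork (C.head k) (a.2.2 k).2 }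

/-- The configuration after `t` steps on input `w`. -/
def run (M : OfflineTM α) (w : List α) (t : ℕ) : M.Cfg :=
  (M.step w)^[t] M.init

/-- `M` halts on input `w` with answer `b`. -/
def HaltsWith (M : OfflineTM α) (w : List α) (b : Bool) : Prop :=
  ∃ t, M.verdict (M.run w t).state = some b

/-- `M` halts on every input, accepting exactly the words of `L`. -/
def Decides (M : OfflineTM α) (L : Language α) : Prop :=
  ∀ w : List α, (w ∈ L → M.HaltsWith w true) ∧ (w ∉ L → M.HaltsWith w false)

/-- On each input of length `n`, only the first `s n` cells of each work tape are
ever visited. -/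
def RunsInSpace (M : OfflineTM α) (s : ℕ → ℕ) : Prop :=
  ∀ (w : List α) (t : ℕ) (k : M.K), (M.run w t).head k < s w.length

/-- `M` uses `O(log n)` cells of its work tapes on inputs of length `n`. -/
def RunsInLogspace (M : OfflineTM α) : Prop :=
  ∃ s : ℕ → ℕ, ((fun n => (s n : ℝ)) =O[atTop] fun n => Real.log (n : ℝ)) ∧ M.RunsInSpace s

end OfflineTM

/-- Deterministic logarithmic space: the class `L` of languages over `α`. -/
def LOGSPACE (α : Type) [Finite α] : Set (Language α) :=
  {L | ∃ M : OfflineTM α, M.RunsInLogspace ∧ M.Decides L}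

/-! ### Unary Subset-Sum -/

/-- An instance of Subset-Sum: integers `m₁, …, mₙ` and a target `B`. -/
structure SubsetSum where
  n : ℕ
  m : Fin n → ℤ
  B : ℤ

/-- The alphabet of the unary encoding. -/
inductive UnarySymbol where
  | one
  | minus
  | sep
  deriving DecidableEq

instance : Finite UnarySymbol :=
  Finite.of_surjective (fun i : Fin 3 => ![UnarySymbol.one, .minus, .sep] i) (by
    rintro (_ | _ | _)
    exacts [⟨0, rfl⟩, ⟨1, rfl⟩, ⟨2, rfl⟩])

/-- `z` in unary: a minus sign if `z < 0`, then `|z|` ones, then a terminating separator. -/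
def unaryInt (z : ℤ) : List UnarySymbol :=
  (if z < 0 then [.minus] else []) ++ List.replicate z.natAbs .one ++ [.sep]

namespace SubsetSum

/-- The instance as a word: `B, m₁, …, mₙ` in unary. -/
def encode (I : SubsetSum) : List UnarySymbol :=
  unaryInt I.B ++ (List.ofFn I.m).flatMap unaryInt

/-- The number `A` of subsets `S` with `∑_{i ∈ S} mᵢ = B`. -/
def numSolutions (I : SubsetSum) : ℕ :=
  (Finset.univ.filter fun S : Finset (Fin I.n) => ∑ i ∈ S, I.m i = I.B).card

/-- There is a subset `S` with `∑_{i ∈ S} mᵢ = B`. -/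
def Solvable (I : SubsetSum) : Prop :=
  ∃ S : Finset (Fin I.n), ∑ i ∈ S, I.m i = I.B

/-- `C = |B| + ∑ |mᵢ| + 1`. -/
def C (I : SubsetSum) : ℕ :=
  I.B.natAbs + ∑ i, (I.m i).natAbs + 1

/-- `∑_{x=1}^{p-1} x^{-B} ∏ᵢ (1 + x^{mᵢ})` modulo the prime `p`. -/
noncomputable def powerSum (I : SubsetSum) (p : ℕ) [Fact p.Prime] : ZMod p :=
  ∑ x ∈ Finset.Icc 1 (p - 1), (x : ZMod p) ^ (-I.B) * ∏ i, (1 + (x : ZMod p) ^ (I.m i))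

end SubsetSum

/-- The language of all encodings of solvable instances. -/
def unarySubsetSum : Language UnarySymbol :=
  {w | ∃ I : SubsetSum, I.encode = w ∧ I.Solvable}

/-! ### The algorithm -/

/-- The least prime larger than `k`. -/
def nextPrime (k : ℕ) : Nat.Primes :=
  ⟨Nat.find (Nat.exists_infinite_primes (k + 1)),
    (Nat.find_spec (Nat.exists_infinite_primes (k + 1))).2⟩

/-- A state of the algorithm: at the head of the while loop with given values of the variables `c`
and `p`, or finished with a returned truth value. -/
inductive AlgState where
  | loop (c : ℕ) (p : Nat.Primes)
  | done (b : Bool)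

namespace SubsetSum

open Classical in
/-- One passage through the while loop: if `c ≤ n` fails, return false; if the power sum is nonzero
modulo `p`, return true; otherwise `c := c + ⌊log₂ p⌋` and `p := NextPrime p`. -/
noncomputable def algStep (I : SubsetSum) : AlgState → AlgState
  | .loop c p =>
    haveI : Fact (p : ℕ).Prime := ⟨p.2⟩
    if c ≤ I.n then
      if I.powerSum p ≠ 0 then .done true
      else .loop (c + Nat.log 2 p) (nextPrime p)
    else .done false
  | .done b => .done b

/-- The state of the algorithm after `j` passages, starting with `c := 0`, `p := NextPrime C`. -/
noncomputable def algRun (I : SubsetSum) (j : ℕ) : AlgState :=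
  I.algStep^[j] (.loop 0 (nextPrime I.C))

/-- The algorithm terminates and returns `b`. -/
def AlgReturns (I : SubsetSum) (b : Bool) : Prop :=
  ∃ j, I.algRun j = .done b

/-- The product of the primes checked before the value `p` is reached, that is, of the
primes `q` with `C < q < p`. -/
def checkedProduct (I : SubsetSum) (p : ℕ) : ℕ :=
  ∏ q ∈ (Finset.Ioo I.C p).filter Nat.Prime, q

end SubsetSum

/-- A configuration of a machine represents a state of the algorithm. The state `loop c p` is
represented by the machine state `q`, with `p` and `c` stored in binary on the work tapes `kp` and
`kc` (bit `i` in cell `i`, where the symbol `g` carries the bit `bit g`). The state `done b` is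
represented by every halting configuration with answer `b`. -/
def OfflineTM.Represents {α : Type} (M : OfflineTM α) (q : M.Q) (kp kc : M.K) (bit : M.Γ → Bool)
    (X : M.Cfg) : AlgState → Prop
  | .loop c p => X.state = q ∧ (∀ i, bit (X.tape kp i) = (p : ℕ).testBit i) ∧
      ∀ i, bit (X.tape kc i) = c.testBit i
  | .done b => M.verdict X.state = some b

/-- `M`, started on the encoding of an instance, carries out the algorithm: it passes, at
successive times, through configurations representing the successive states of the algorithm. -/
def OfflineTM.CarriesOutAlg (M : OfflineTM UnarySymbol) : Prop :=
  ∃ (q : M.Q) (kp kc : M.K) (bit : M.Γ → Bool), ∀ I : SubsetSum, ∃ τ : ℕ → ℕ, StrictMono τ ∧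
    ∀ j, M.Represents q kp kc bit (M.run I.encode (τ j)) (I.algRun j)

/-!
The power sum modulo a prime `p > C` can be expanded over all subsets `S`: it is the sum of
`x ^ (∑_{i ∈ S} mᵢ - B)` over `S` and over the units `x` of `ℤ/p`. The exponents are smaller than
`p - 1` in absolute value, so orthogonality of characters (`ZMod.sum_Icc_zpow`) leaves exactly the
solutions, and the power sum is `-A` (`SubsetSum.powerSum_eq`). Hence a prime that does not lead to
the answer `true` divides `A`, and the checked primes have a product of at least `2 ^ c` which
divides `A ≤ 2 ^ n` (`SubsetSum.loopInvariant`); for `c > n` this forces `A = 0`. The bound on the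
primes comes from Chebyshev's estimate `2 ^ N ≤ (N + 1) * lcm (1, …, N) ≤ (N + 1) * N ^ π(N)`.

The machine is assembled from fragments (`Frag`): pieces of a transition table with one entry and
several exits, closed under sequential composition `Frag.bind` and iteration `Frag.iter`. Each tape
is a register that holds a number in binary; the elementary fragments increment, clear and compare
registers and look at the input. Everything else is a nest of counting loops (`Frag.forLoop`) and
scans of the input (`Frag.forInput`), since the running time does not matter. Primes are found by
trial division, products modulo `p` by repeated addition, and inverses modulo `p` as powers with
exponent `p - 2`. The specification `Frag.Maps` of a fragment gives the exact register contents
after its execution, auxiliary registers being zero before and after, and includes the space bound: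
with all registers below `2 ^ B`, no work head leaves the first `B + 1` cells. All values that occur
are polynomial in the length `N` of the input, so that `B = O(log N)` suffices
(`subsetSumTM.runsInSpace`).

The control state at the head of the while loop is the entry of the iterated fragment
`Frag.loopBody`. An execution of this fragment is one step `SubsetSum.algStep` of the algorithm,
which gives the times at which the machine represents the successive states of the algorithm
(`subsetSumTM.exists_reached`). Words that do not encode an instance are rejected beforehand by a
finite automaton (`exists_encode_eq_iff`).
-/

/-! ### Prime numbers -/

/-- Each of the prime powers in `lcm (1, …, n)` is at most `n`. -/
theorem lcmUpto_le_pow_primeCounting (n : ℕ) : Nat.lcmUpto n ≤ n ^ Nat.primeCounting n := by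
  rw [Nat.lcmUpto_eq_prod_pow_log, ← Nat.primesLE_card_eq_primeCounting]
  refine Finset.prod_le_pow_card _ _ _ fun p hp => ?_
  have hn : n ≠ 0 := by
    rintro rfl
    simp [Nat.primesLE] at hp
  exact Nat.pow_log_le_self p hn

/-- A weak form of Chebyshev's lower bound for the number of primes up to `x ^ 6`. -/
theorem two_mul_le_primeCounting_pow {x : ℕ} (hx : 2 ≤ x) :
    2 * x ≤ Nat.primeCounting (x ^ 6) := by
  by_contra! h
  have hx1 : 1 ≤ x ^ 6 := Nat.one_le_pow _ _ (by omega)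
  have h2 : x ≤ 2 ^ x := Nat.lt_two_pow_self.le
  -- otherwise `2 ^ (x ^ 6)` is at most `2 * (x ^ 6) ^ (2 * x)`, and `x ≤ 2 ^ x`
  have key : 2 ^ (x ^ 6) < 2 ^ (14 * x ^ 2) := by
    calc 2 ^ (x ^ 6) ≤ (x ^ 6 + 1) * Nat.lcmUpto (x ^ 6) := Chebyshev.two_pow_le_mul_lcmUpto _
      _ ≤ (x ^ 6 + 1) * (x ^ 6) ^ Nat.primeCounting (x ^ 6) := by
        gcongr
        exact lcmUpto_le_pow_primeCounting _
      _ ≤ (x ^ 6 + 1) * (x ^ 6) ^ (2 * x - 1) := by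
        gcongr
        omega
      _ ≤ (2 * x ^ 6) * (x ^ 6) ^ (2 * x - 1) := by
        gcongr
        omega
      _ = 2 * (x ^ 6) ^ (2 * x - 1 + 1) := by ring
      _ = 2 * x ^ (12 * x) := by
        rw [show 2 * x - 1 + 1 = 2 * x by omega, ← pow_mul]
        ring_nf
      _ ≤ 2 * (2 ^ x) ^ (12 * x) := by gcongr
      _ = 2 ^ (12 * x ^ 2 + 1) := by
        rw [← pow_mul, pow_succ]
        ring_nf
      _ < 2 ^ (14 * x ^ 2) := by
        apply Nat.pow_lt_pow_right (by norm_num)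
        nlinarith
  have := (Nat.pow_lt_pow_iff_right (by norm_num : 1 < 2)).1 key
  have h4 : 16 ≤ x ^ 4 := by
    calc 16 = 2 ^ 4 := by norm_num
      _ ≤ x ^ 4 := by gcongr
  nlinarith [sq_nonneg x, pow_pos (show 0 < x by omega) 2]

/-- The primes up to `X` are those below `C` and those in `[C, X]`. -/
theorem primeCounting_le_add_card (C X : ℕ) :
    Nat.primeCounting X ≤ C + ((Finset.Icc C X).filter Nat.Prime).card := by
  rw [← Nat.primesLE_card_eq_primeCounting]
  calc _ ≤ (Finset.range C ∪ (Finset.Icc C X).filter Nat.Prime).card := by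
        apply Finset.card_le_card
        intro q hq
        rw [Nat.mem_primesLE] at hq
        by_cases h : q < C
        · simp [h]
        · simp only [Finset.mem_union, Finset.mem_filter, Finset.mem_Icc]
          exact Or.inr ⟨⟨by omega, hq.1⟩, hq.2⟩
    _ ≤ _ := by
        refine (Finset.card_union_le _ _).trans ?_
        simp

theorem le_card_primes_Icc {C n : ℕ} (hC : 1 ≤ C) :
    n ≤ ((Finset.Icc C ((C + n + 1) ^ 6)).filter Nat.Prime).card := by
  have h1 := two_mul_le_primeCounting_pow (x := C + n + 1) (by omega)
  have h2 := primeCounting_le_add_card C ((C + n + 1) ^ 6)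
  omega

theorem lt_nextPrime (k : ℕ) : k < (nextPrime k : ℕ) :=
  (Nat.find_spec (Nat.exists_infinite_primes (k + 1))).1

theorem nextPrime_le {k q : ℕ} (hq : q.Prime) (h : k < q) : (nextPrime k : ℕ) ≤ q :=
  Nat.find_min' (Nat.exists_infinite_primes (k + 1)) ⟨h, hq⟩

/-- The orthogonality relation for the characters `x ↦ x ^ k` of the unit group of `ℤ/p`. -/
theorem ZMod.sum_Icc_zpow {p : ℕ} [Fact p.Prime] {k : ℤ} (hk : k.natAbs < p - 1) :
    ∑ x ∈ Finset.Icc 1 (p - 1), (x : ZMod p) ^ k = if k = 0 then -1 else 0 := by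
  have hp : 1 < p := (Fact.out : p.Prime).one_lt
  have e : ∑ x ∈ Finset.Icc 1 (p - 1), (x : ZMod p) ^ k =
      ∑ u : (ZMod p)ˣ, ((u ^ k : (ZMod p)ˣ) : ZMod p) := by
    symm
    refine Finset.sum_bij (fun u _ => (u : ZMod p).val) ?_ ?_ ?_ ?_
    · intro u _
      have h1 : (u : ZMod p).val ≠ 0 := by
        rw [Ne, ZMod.val_eq_zero]
        exact u.ne_zero
      have h2 := ZMod.val_lt (u : ZMod p)
      simp only [Finset.mem_Icc]
      omega
    · intro u _ v _ h
      exact Units.ext (ZMod.val_injective p h)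
    · intro x hx
      rw [Finset.mem_Icc] at hx
      have hx0 : (x : ZMod p) ≠ 0 := by
        rw [Ne, ZMod.natCast_eq_zero_iff]
        exact Nat.not_dvd_of_pos_of_lt (by omega) (by omega)
      exact ⟨Units.mk0 _ hx0, Finset.mem_univ _, by
        simp [ZMod.val_natCast, Nat.mod_eq_of_lt (show x < p by omega)]⟩
    · intro u _
      simp
  rw [e]
  have hN (j : ℕ) (hj : j < p - 1) :
      ∑ u : (ZMod p)ˣ, ((u ^ j : (ZMod p)ˣ) : ZMod p) = if j = 0 then -1 else 0 := by
    have := FiniteField.sum_pow_units (ZMod p) j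
    rw [ZMod.card] at this
    push_cast
    rw [this]
    have hiff : p - 1 ∣ j ↔ j = 0 :=
      ⟨fun h => Nat.eq_zero_of_dvd_of_lt h hj, fun h => h ▸ dvd_zero _⟩
    simp only [hiff]
  rcases le_total 0 k with h | h
  · lift k to ℕ using h
    simp only [zpow_natCast]
    rw [hN k (by simpa using hk)]
    simp
  · obtain ⟨j, rfl⟩ : ∃ j : ℕ, k = -j := ⟨k.natAbs, by omega⟩
    -- inversion permutes the units
    rw [← Equiv.sum_comp (Equiv.inv (ZMod p)ˣ)]
    simp only [Equiv.inv_apply, inv_zpow', neg_neg, zpow_natCast]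
    rw [hN j (by simpa using hk)]
    simp

/-! ### Correctness of the algorithm -/

namespace SubsetSum

variable (I : SubsetSum)

theorem one_le_C : 1 ≤ I.C := by simp [C]

theorem C_lt_nextPrime_C : I.C < nextPrime I.C := lt_nextPrime _

/-- `|∑_{i ∈ S} mᵢ - B| < C` -/
theorem natAbs_sum_sub_lt (S : Finset (Fin I.n)) : (∑ i ∈ S, I.m i - I.B).natAbs < I.C := by
  have h : (∑ i ∈ S, I.m i).natAbs ≤ ∑ i, (I.m i).natAbs :=
    (Int.natAbs_sum_le _ _).trans (Finset.sum_le_sum_of_subset (Finset.subset_univ S))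
  unfold C
  omega

/-- Expanding the product turns the power sum into a sum over all subsets, in which exactly the
solutions survive. -/
theorem powerSum_eq {p : ℕ} [Fact p.Prime] (hp : I.C < p) :
    I.powerSum p = -(I.numSolutions : ZMod p) := by
  have hx (x : ℕ) (hx : x ∈ Finset.Icc 1 (p - 1)) :
      (x : ZMod p) ^ (-I.B) * ∏ i, (1 + (x : ZMod p) ^ (I.m i)) =
        ∑ S : Finset (Fin I.n), (x : ZMod p) ^ (∑ i ∈ S, I.m i - I.B) := by
    rw [Finset.mem_Icc] at hx
    have hx0 : (x : ZMod p) ≠ 0 := by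
      rw [Ne, ZMod.natCast_eq_zero_iff]
      exact Nat.not_dvd_of_pos_of_lt (by omega) (by omega)
    have hprod (S : Finset (Fin I.n)) :
        (x : ZMod p) ^ (∑ i ∈ S, I.m i) = ∏ i ∈ S, (x : ZMod p) ^ I.m i := by
      induction S using Finset.cons_induction with
      | empty => simp
      | cons a s ha ih => rw [Finset.sum_cons, Finset.prod_cons, zpow_add₀ hx0, ih]
    rw [Finset.prod_one_add, Finset.mul_sum, Finset.powerset_univ]
    refine Finset.sum_congr rfl fun S _ => ?_
    rw [sub_eq_neg_add, zpow_add₀ hx0, hprod]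
  rw [powerSum, Finset.sum_congr rfl hx, Finset.sum_comm]
  have hS (S : Finset (Fin I.n)) :
      ∑ x ∈ Finset.Icc 1 (p - 1), (x : ZMod p) ^ (∑ i ∈ S, I.m i - I.B) =
        if ∑ i ∈ S, I.m i = I.B then -1 else 0 := by
    rw [ZMod.sum_Icc_zpow (by have := I.natAbs_sum_sub_lt S; omega)]
    simp only [sub_eq_zero]
  simp only [hS]
  rw [← Finset.sum_filter, Finset.sum_const, numSolutions]
  simp

theorem powerSum_eq_zero_iff {p : ℕ} [Fact p.Prime] (hp : I.C < p) :
    I.powerSum p = 0 ↔ p ∣ I.numSolutions := by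
  rw [I.powerSum_eq hp, neg_eq_zero, ZMod.natCast_eq_zero_iff]

theorem numSolutions_le : I.numSolutions ≤ 2 ^ I.n := by
  refine (Finset.card_filter_le _ _).trans ?_
  simp

theorem solvable_iff : I.Solvable ↔ I.numSolutions ≠ 0 := by
  simp [Solvable, numSolutions]

theorem filter_Ioo_nextPrime {p : ℕ} (hp : p.Prime) (h : I.C < p) :
    (Finset.Ioo I.C (nextPrime p : ℕ)).filter Nat.Prime =
      insert p ((Finset.Ioo I.C p).filter Nat.Prime) := by
  ext q
  simp only [Finset.mem_filter, Finset.mem_Ioo, Finset.mem_insert]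
  constructor
  · rintro ⟨⟨h1, h2⟩, h3⟩
    by_cases hq : p < q
    · exact absurd (nextPrime_le h3 hq) (by omega)
    · by_cases hq : q = p
      · exact Or.inl hq
      · exact Or.inr ⟨⟨h1, by omega⟩, h3⟩
  · have := lt_nextPrime p
    rintro (rfl | ⟨⟨h1, h2⟩, h3⟩)
    · exact ⟨⟨h, this⟩, hp⟩
    · exact ⟨⟨h1, by omega⟩, h3⟩

theorem filter_Ioo_nextPrime_C : (Finset.Ioo I.C (nextPrime I.C : ℕ)).filter Nat.Prime = ∅ := by
  rw [Finset.filter_eq_empty_iff]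
  intro q hq hp
  rw [Finset.mem_Ioo] at hq
  exact absurd (nextPrime_le hp hq.1) (by omega)

theorem checkedProduct_nextPrime {p : ℕ} (hp : p.Prime) (h : I.C < p) :
    I.checkedProduct (nextPrime p) = I.checkedProduct p * p := by
  rw [checkedProduct, I.filter_Ioo_nextPrime hp h, Finset.prod_insert (by simp), mul_comm,
    checkedProduct]

theorem checkedProduct_nextPrime_C : I.checkedProduct (nextPrime I.C) = 1 := by
  rw [checkedProduct, I.filter_Ioo_nextPrime_C, Finset.prod_empty]

theorem algRun_succ (j : ℕ) : I.algRun (j + 1) = I.algStep (I.algRun j) :=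
  Function.iterate_succ_apply' _ _ _

theorem algStep_eq_loop {s : AlgState} {c : ℕ} {p : Nat.Primes} (h : I.algStep s = .loop c p) :
    ∃ (c' : ℕ) (p' : Nat.Primes), s = .loop c' p' ∧ c' ≤ I.n ∧
      (haveI : Fact (p' : ℕ).Prime := ⟨p'.2⟩; I.powerSum p' = 0) ∧
      c = c' + Nat.log 2 p' ∧ p = nextPrime p' := by
  cases s with
  | done b => simp [algStep] at h
  | loop c' p' =>
    simp only [algStep] at h
    split_ifs at h with h1 h2
    simp only [AlgState.loop.injEq] at h
    exact ⟨c', p', rfl, h1, not_not.1 h2, h.1.symm, h.2.symm⟩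

/-- The loop invariant: the product of the checked primes divides the number of solutions and is
at least `2 ^ c`, and at most `c` and at most `n + 1` primes have been checked. -/
structure LoopInvariant (c : ℕ) (p : Nat.Primes) : Prop where
  C_lt : I.C < p
  dvd : I.checkedProduct p ∣ I.numSolutions
  two_pow_le : 2 ^ c ≤ I.checkedProduct p
  card_le : ((Finset.Ioo I.C (p : ℕ)).filter Nat.Prime).card ≤ c
  card_le_succ : ((Finset.Ioo I.C (p : ℕ)).filter Nat.Prime).card ≤ I.n + 1
  le : c ≤ I.n + p

theorem loopInvariant : ∀ {j c : ℕ} {p : Nat.Primes}, I.algRun j = .loop c p →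
    I.LoopInvariant c p
  | 0, c, p, h => by
    simp only [algRun, Function.iterate_zero, id, AlgState.loop.injEq] at h
    obtain ⟨rfl, rfl⟩ := h
    exact ⟨I.C_lt_nextPrime_C, by simp [I.checkedProduct_nextPrime_C],
      by simp [I.checkedProduct_nextPrime_C], by simp [I.filter_Ioo_nextPrime_C],
      by simp [I.filter_Ioo_nextPrime_C],
      by simp⟩
  | j + 1, c, p, h => by
    rw [algRun_succ] at h
    obtain ⟨c', p', hs, hc, h0, rfl, rfl⟩ := I.algStep_eq_loop h
    have ih := loopInvariant hs
    have : Fact (p' : ℕ).Prime := ⟨p'.2⟩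
    have hdvd := (I.powerSum_eq_zero_iff ih.C_lt).1 h0
    have hlog : 1 ≤ Nat.log 2 p' := Nat.log_pos (by norm_num) p'.2.two_le
    have hlt := lt_nextPrime p'
    have hins := Finset.card_insert_le (p' : ℕ) ((Finset.Ioo I.C (p' : ℕ)).filter Nat.Prime)
    rw [← I.filter_Ioo_nextPrime p'.2 ih.C_lt] at hins
    have := Nat.log_le_self 2 p'
    refine ⟨ih.C_lt.trans hlt, ?_, ?_, ?_, ?_, by omega⟩
    · rw [I.checkedProduct_nextPrime p'.2 ih.C_lt]
      refine Nat.Coprime.mul_dvd_of_dvd_of_dvd ?_ ih.dvd hdvd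
      refine Nat.Coprime.prod_left fun q hq => ?_
      rw [Finset.mem_filter, Finset.mem_Ioo] at hq
      exact (Nat.coprime_primes hq.2 p'.2).2 (by omega)
    · rw [I.checkedProduct_nextPrime p'.2 ih.C_lt, pow_add]
      exact Nat.mul_le_mul ih.two_pow_le (Nat.pow_log_le_self 2 p'.2.ne_zero)
    · have := ih.card_le
      omega
    · have := ih.card_le
      omega

theorem two_pow_lt_checkedProduct {j c : ℕ} {p : Nat.Primes} (h : I.algRun j = .loop c p)
    (hc : I.n < c) : 2 ^ I.n < I.checkedProduct p :=
  (Nat.pow_lt_pow_right (by norm_num) hc).trans_le (I.loopInvariant h).two_pow_le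

/-- The answer `true` exhibits a prime that does not divide `A`; the answer `false` means that `A`
has a divisor exceeding `2 ^ n`. -/
theorem algRun_eq_done_correct : ∀ {j : ℕ} {b : Bool}, I.algRun j = .done b →
    (b = true ↔ I.Solvable)
  | 0, b, h => by simp [algRun] at h
  | j + 1, b, h => by
    rw [algRun_succ] at h
    cases hs : I.algRun j with
    | done b' =>
      rw [hs] at h
      simp only [algStep, AlgState.done.injEq] at h
      exact h ▸ algRun_eq_done_correct hs
    | loop c p =>
      have inv := I.loopInvariant hs
      have : Fact (p : ℕ).Prime := ⟨p.2⟩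
      rw [hs] at h
      simp only [algStep] at h
      rw [solvable_iff]
      split_ifs at h with h1 h2
      · simp only [AlgState.done.injEq] at h
        subst h
        rw [Ne, I.powerSum_eq_zero_iff inv.C_lt] at h2
        simp only [true_iff]
        intro h0
        exact h2 (h0 ▸ dvd_zero _)
      · simp only [AlgState.done.injEq] at h
        subst h
        simp only [Bool.false_eq_true, false_iff, not_not]
        by_contra h0
        have h3 := Nat.le_of_dvd (Nat.pos_of_ne_zero h0) inv.dvd
        have h4 := I.two_pow_lt_checkedProduct hs (by omega)
        have h5 := I.numSolutions_le
        omega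

/-- Every passage through the loop increases `c`, so the algorithm terminates. -/
theorem exists_algReturns : ∃ b, I.AlgReturns b := by
  by_contra! H
  have hloop (j : ℕ) : ∃ c p, I.algRun j = .loop c p := by
    cases hs : I.algRun j with
    | done b => exact absurd ⟨j, hs⟩ (H b)
    | loop c p => exact ⟨c, p, rfl⟩
  have hc (j : ℕ) : ∃ c p, I.algRun j = .loop c p ∧ j ≤ c := by
    induction j with
    | zero =>
      obtain ⟨c, p, h⟩ := hloop 0
      exact ⟨c, p, h, Nat.zero_le _⟩
    | succ j ih =>
      obtain ⟨c, p, h, hj⟩ := ih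
      obtain ⟨c', p', h'⟩ := hloop (j + 1)
      refine ⟨c', p', h', ?_⟩
      rw [algRun_succ] at h'
      obtain ⟨c'', p'', hs, -, -, rfl, -⟩ := I.algStep_eq_loop h'
      rw [h, AlgState.loop.injEq] at hs
      have hlog : 1 ≤ Nat.log 2 p'' := Nat.log_pos (by norm_num) p''.2.two_le
      omega
  obtain ⟨c, p, h, hj⟩ := hc (I.n + 1)
  obtain ⟨c', p', h'⟩ := hloop (I.n + 1 + 1)
  rw [algRun_succ] at h'
  obtain ⟨c'', p'', hs, hle, -⟩ := I.algStep_eq_loop h'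
  rw [h, AlgState.loop.injEq] at hs
  omega

/-- The value of the algorithm is unique, and it is the correct one. -/
theorem algReturns_iff (b : Bool) : I.AlgReturns b ↔ (b = true ↔ I.Solvable) := by
  constructor
  · rintro ⟨j, h⟩
    exact I.algRun_eq_done_correct h
  · intro hb
    obtain ⟨b', j, h⟩ := I.exists_algReturns
    have := I.algRun_eq_done_correct h
    have : b = b' := by
      rw [Bool.eq_iff_iff, hb, this]
    exact this ▸ ⟨j, h⟩

/-- At most `n + 1` primes have been checked, while there are more primes between `C` and the
bound. -/
theorem prime_le_pow {j c : ℕ} {p : Nat.Primes} (h : I.algRun j = .loop c p) :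
    (p : ℕ) ≤ (I.C + I.n + 1) ^ 6 := by
  by_contra! hlt
  have hC := I.one_le_C
  have inv := (I.loopInvariant h).card_le_succ
  have h1 := two_mul_le_primeCounting_pow (x := I.C + I.n + 1) (by omega)
  have h2 := primeCounting_le_add_card (I.C + 1) ((I.C + I.n + 1) ^ 6)
  have h3 : ((Finset.Icc (I.C + 1) ((I.C + I.n + 1) ^ 6)).filter Nat.Prime).card ≤
      ((Finset.Ioo I.C (p : ℕ)).filter Nat.Prime).card := by
    apply Finset.card_le_card
    intro q
    simp only [Finset.mem_filter, Finset.mem_Icc, Finset.mem_Ioo]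
    rintro ⟨⟨h4, h5⟩, h6⟩
    exact ⟨⟨by omega, by omega⟩, h6⟩
  omega

end SubsetSum

/-! ### Program fragments -/

/-- The data of a configuration apart from the control state: the position of the input head, the
work tapes and the positions of their heads. -/
structure Memory (K Γ : Type) where
  inputPos : ℕ
  tape : K → ℕ → Γ
  head : K → ℕ

/-- Actions of one step: the move of the input head, and for each work tape the symbol to be
written and the move of its head. -/
abbrev TapeAction (K Γ : Type) := HeadMove × (K → Γ × HeadMove)

/-- The memory after an action, on input `w`. -/
def Memory.act {α K Γ : Type} (w : List α) (D : Memory K Γ) (a : TapeAction K Γ) : Memory K Γ where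
  inputPos := OfflineTM.moveInput w D.inputPos a.1
  tape := fun k => Function.update (D.tape k) (D.head k) (a.2 k).1
  head := fun k => OfflineTM.moveWork (D.head k) (a.2 k).2

/-- A piece of a machine with one entry state and one exit for each element of `E`: a step leads
either to another state of the piece or out of it through one of the exits. -/
structure Frag (α K Γ E : Type) where
  /-- states -/
  Q : Type
  [finQ : Finite Q]
  entry : Q
  δ : Q → InputCell α → (K → Γ) → (Q ⊕ E) × TapeAction K Γ

attribute [instance] Frag.finQ

namespace Frag

variable {α K Γ E E' S : Type}

/-- The result of one step from state `q` with memory `D`. -/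
def next (F : Frag α K Γ E) (w : List α) (q : F.Q) (D : Memory K Γ) : (F.Q ⊕ E) × Memory K Γ :=
  Prod.map id (D.act w) (F.δ q (OfflineTM.inputCell w D.inputPos) fun k => D.tape k (D.head k))

/-- One step of a fragment, taken with all work heads at positions below `V`. -/
inductive Step (F : Frag α K Γ E) (w : List α) (V : ℕ) :
    (F.Q ⊕ E) × Memory K Γ → (F.Q ⊕ E) × Memory K Γ → Prop
  | mk (q : F.Q) (D : Memory K Γ) (h : ∀ k, D.head k < V) : Step F w V (.inl q, D) (F.next w q D)

/-- A positive number of steps, with all work heads at positions below `V`. -/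
def Path (F : Frag α K Γ E) (w : List α) (V : ℕ) :
    (F.Q ⊕ E) × Memory K Γ → (F.Q ⊕ E) × Memory K Γ → Prop :=
  Relation.TransGen (F.Step w V)

theorem Path.trans {F : Frag α K Γ E} {w : List α} {V : ℕ} {x y z} (h : F.Path w V x y)
    (h' : F.Path w V y z) : F.Path w V x z :=
  Relation.TransGen.trans h h'

theorem Path.of_next {F : Frag α K Γ E} {w : List α} {V : ℕ} {q : F.Q} {D : Memory K Γ} {y}
    (h : ∀ k, D.head k < V) (hy : F.next w q D = y) : F.Path w V (.inl q, D) y :=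
  .single (hy ▸ ⟨q, D, h⟩)

/-- A map of control states that commutes with single steps maps paths to paths. -/
theorem Path.map {F : Frag α K Γ E} {G : Frag α K Γ E'} {w : List α} {V : ℕ}
    (φ : F.Q ⊕ E → G.Q ⊕ E') (ψ : F.Q → G.Q) (hψ : ∀ q, φ (.inl q) = .inl (ψ q))
    (hφ : ∀ q D, G.next w (ψ q) D = Prod.map φ id (F.next w q D)) {x y}
    (h : F.Path w V x y) : G.Path w V (Prod.map φ id x) (Prod.map φ id y) := by
  refine Relation.TransGen.lift (Prod.map φ id) ?_ _ _ h
  rintro _ _ ⟨q, D, hD⟩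
  simp only [Function.onFun, Prod.map_apply, hψ, id, ← hφ]
  exact ⟨_, _, hD⟩

/-- A fragment that leaves at once through exit `e`. -/
def pure (e : E) : Frag α K Γ E where
  Q := Unit
  entry := ()
  δ := fun _ _ r => (.inr e, .stay, fun k => (r k, .stay))

/-- Run `F`, then the fragment `G e` where `e` is the exit through which `F` was left. -/
def bind [Finite E] (F : Frag α K Γ E) (G : E → Frag α K Γ E') : Frag α K Γ E' where
  Q := F.Q ⊕ Σ e, (G e).Q
  entry := .inl F.entry
  δ
    | .inl q, c, r => Prod.map
        (fun x => .inl (x.map id fun e => ⟨e, (G e).entry⟩)) id (F.δ q c r)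
    | .inr ⟨e, q⟩, c, r => Prod.map (Sum.map (fun q' => .inr ⟨e, q'⟩) id) id ((G e).δ q c r)

/-- Run `F s`; if it is left through an exit `inr s'`, start again with `F s'`. -/
def iter [Finite S] (F : S → Frag α K Γ (E ⊕ S)) (s : S) : Frag α K Γ E where
  Q := Σ s, (F s).Q
  entry := ⟨s, (F s).entry⟩
  δ := fun q c r => Prod.map
    (Sum.elim (fun q' => .inl ⟨q.1, q'⟩) (Sum.elim .inr fun s' => .inl ⟨s', (F s').entry⟩)) id
    ((F q.1).δ q.2 c r)

/-- Run `F`, then `G`. -/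
def seq (F : Frag α K Γ Unit) (G : Frag α K Γ E) : Frag α K Γ E := F.bind fun _ => G

/-- Run `F`, then `G` or `H` according to the exit. -/
def cond (F : Frag α K Γ Bool) (G H : Frag α K Γ E) : Frag α K Γ E :=
  F.bind fun
    | true => G
    | false => H

variable {w : List α} {V : ℕ} {D D' D'' : Memory K Γ} {e : E} {e' : E'} {s s' : S}

theorem path_bind_left [Finite E] {F : Frag α K Γ E} {G : E → Frag α K Γ E'} {q : F.Q}
    (h : F.Path w V (.inl q, D) (.inr e, D')) :
    (F.bind G).Path w V (.inl (.inl q), D) (.inl (.inr ⟨e, (G e).entry⟩), D') :=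
  h.map (G := F.bind G) (fun x => .inl (x.map id fun e => ⟨e, (G e).entry⟩)) Sum.inl
    (fun _ => rfl) (fun _ _ => rfl)

theorem path_bind_right [Finite E] {F : Frag α K Γ E} {G : E → Frag α K Γ E'} {q : (G e).Q}
    {x : (G e).Q ⊕ E'} (h : (G e).Path w V (.inl q, D) (x, D')) :
    (F.bind G).Path w V (.inl (.inr ⟨e, q⟩), D)
      (x.map (fun q' => .inr ⟨e, q'⟩) id, D') :=
  h.map (G := F.bind G) (Sum.map (fun q' => .inr ⟨e, q'⟩) id) (fun q' => Sum.inr ⟨e, q'⟩)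
    (fun _ => rfl) (fun _ _ => rfl)

theorem path_iter [Finite S] {F : S → Frag α K Γ (E ⊕ S)} {s₀ : S} {q : (F s).Q}
    {x : (F s).Q ⊕ (E ⊕ S)} (h : (F s).Path w V (.inl q, D) (x, D')) :
    (iter F s₀).Path w V (.inl ⟨s, q⟩, D)
      (x.elim (fun q' => .inl ⟨s, q'⟩) (Sum.elim .inr fun s' => .inl ⟨s', (F s').entry⟩), D') :=
  h.map (G := iter F s₀) (Sum.elim (fun q' => .inl ⟨s, q'⟩)
    (Sum.elim .inr fun s' => .inl ⟨s', (F s').entry⟩)) (fun q' => ⟨s, q'⟩)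
    (fun _ => rfl) (fun _ _ => rfl)

/-- The starting state of an iteration matters only for its entry. -/
theorem path_iter_congr [Finite S] {F : S → Frag α K Γ (E ⊕ S)} {s₀ s₁ : S} {x y}
    (h : (iter F s₀).Path w V x y) : (iter F s₁).Path w V x y :=
  Path.map (F := iter F s₀) (G := iter F s₁) id id (fun _ => rfl) (fun _ _ => rfl) h

/-- Started at its entry with memory `D`, the fragment is left through exit `e` with memory `D'`,
all work heads staying at positions below `V`. -/
def Runs (F : Frag α K Γ E) (w : List α) (V : ℕ) (D : Memory K Γ) (e : E) (D' : Memory K Γ) :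
    Prop :=
  F.Path w V (.inl F.entry, D) (.inr e, D')

theorem Runs.bind [Finite E] {F : Frag α K Γ E} {G : E → Frag α K Γ E'} (h : F.Runs w V D e D')
    (h' : (G e).Runs w V D' e' D'') : (F.bind G).Runs w V D e' D'' :=
  (path_bind_left h).trans (path_bind_right h')

theorem Runs.seq {F : Frag α K Γ Unit} {G : Frag α K Γ E} (h : F.Runs w V D () D')
    (h' : G.Runs w V D' e D'') : (F.seq G).Runs w V D e D'' :=
  h.bind h'

theorem Runs.cond_true {F : Frag α K Γ Bool} {G H : Frag α K Γ E} (h : F.Runs w V D true D')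
    (h' : G.Runs w V D' e D'') : (F.cond G H).Runs w V D e D'' :=
  h.bind h'

theorem Runs.cond_false {F : Frag α K Γ Bool} {G H : Frag α K Γ E} (h : F.Runs w V D false D')
    (h' : H.Runs w V D' e D'') : (F.cond G H).Runs w V D e D'' :=
  h.bind h'

theorem Runs.iter_exit [Finite S] {F : S → Frag α K Γ (E ⊕ S)}
    (h : (F s).Runs w V D (.inl e) D') : (iter F s).Runs w V D e D' :=
  path_iter h

theorem Runs.iter_again [Finite S] {F : S → Frag α K Γ (E ⊕ S)}
    (h : (F s).Runs w V D (.inr s') D') (h' : (iter F s').Runs w V D' e D'') :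
    (iter F s).Runs w V D e D'' :=
  (path_iter (s₀ := s) h).trans (path_iter_congr (s₀ := s') (s₁ := s)
    (x := (.inl (iter F s').entry, D')) (y := (.inr e, D'')) h')

theorem runs_pure (h : ∀ k, D.head k < V) : (pure e : Frag α K Γ E).Runs w V D e D := by
  refine .of_next h ?_
  simp [next, pure, Memory.act, OfflineTM.moveInput, OfflineTM.moveWork]

/-! ### Machines from fragments -/

/-- The machine that starts at the entry of the fragment and halts with the answer given by the
exit. -/
def toTM [Finite K] [Finite Γ] (F : Frag α K Γ Bool) (blank : Γ) : OfflineTM α where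
  Q := F.Q ⊕ Bool
  K := K
  Γ := Γ
  blank := blank
  start := .inl F.entry
  verdict := Sum.elim (fun _ => none) some
  δ
    | .inl q, c, r => F.δ q c r
    | .inr b, _, r => (.inr b, .stay, fun k => (r k, .stay))

/-- The configuration of the machine with given control state and memory. -/
def toCfg [Finite K] [Finite Γ] (F : Frag α K Γ Bool) (blank : Γ) (x : (F.Q ⊕ Bool) × Memory K Γ) :
    (F.toTM blank).Cfg where
  state := x.1
  inputPos := x.2.inputPos
  tape := x.2.tape
  head := x.2.head

/-- A path of the fragment is a run of the machine. -/
theorem Path.exists_iterate [Finite K] [Finite Γ] {F : Frag α K Γ Bool} {blank : Γ} {x y}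
    (h : F.Path w V x y) :
    ∃ t, 0 < t ∧ ((F.toTM blank).step w)^[t] (F.toCfg blank x) = F.toCfg blank y ∧
      ∀ t' < t, ∀ k, (((F.toTM blank).step w)^[t'] (F.toCfg blank x)).head k < V := by
  induction h with
  | single h =>
    obtain ⟨q, D, hD⟩ := h
    refine ⟨1, one_pos, rfl, ?_⟩
    intro t' ht'
    obtain rfl : t' = 0 := by omega
    exact hD
  | tail _ h ih =>
    obtain ⟨t, ht, e, hb⟩ := ih
    obtain ⟨q, D, hD⟩ := h
    refine ⟨t + 1, by omega, ?_, ?_⟩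
    · rw [Function.iterate_succ_apply', e]
      rfl
    · intro t' ht'
      rcases Nat.lt_succ_iff_lt_or_eq.1 ht' with h | rfl
      · exact hb t' h
      · rw [e]
        exact hD

end Frag

theorem OfflineTM.run_add {α : Type} (M : OfflineTM α) (w : List α) (t u : ℕ) :
    M.run w (t + u) = (M.step w)^[u] (M.run w t) := by
  rw [run, run, add_comm, Function.iterate_add_apply]

theorem OfflineTM.run_of_halted {α : Type} (M : OfflineTM α) (w : List α) {t : ℕ} {b : Bool}
    (h : M.verdict (M.run w t).state = some b) (u : ℕ) : M.run w (t + u) = M.run w t := by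
  rw [M.run_add]
  refine Function.iterate_fixed ?_ u
  simp [step, h]

/-! ### Binary registers -/

/-- The `i`-th binary digit of `v`, or `none` beyond the leading digit. -/
def digit : ℕ → ℕ → Option Bool
  | v, 0 => if v = 0 then none else some (decide (v % 2 = 1))
  | v, i + 1 => digit (v / 2) i

theorem digit_zero_left : ∀ i, digit 0 i = none
  | 0 => rfl
  | i + 1 => digit_zero_left i

theorem digit_beq_some_true : ∀ v i, (digit v i == some true) = v.testBit i
  | v, 0 => by
    rcases Nat.mod_two_eq_zero_or_one v with h | h
    · by_cases hv : v = 0 <;> simp [digit, h, hv, Nat.testBit_zero]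
    · have hv : v ≠ 0 := by
        rintro rfl
        simp at h
      simp [digit, h, hv, Nat.testBit_zero]
  | v, i + 1 => by rw [digit, digit_beq_some_true (v / 2) i, Nat.testBit_succ]

/-- The work alphabet: a flag that marks the leftmost cell of a tape, and a binary digit or a
blank. -/
abbrev Cell := Bool × Option Bool

/-- The memory in which each work tape `k` holds the number `σ k` in binary, least significant digit
first, and all work heads are in the leftmost cells. -/
def store {K : Type} (σ : K → ℕ) (pos : ℕ) : Memory K Cell where
  inputPos := pos
  tape := fun k i => (decide (i = 0), digit (σ k) i)
  head := fun _ => 0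

namespace Frag

variable {α K E E' S : Type} {w : List α} {B : ℕ} {pos : ℕ}

/-- The fragment transforms the register contents `σ` into `σ'`, leaving through exit `e`, with the
input head at position `pos` before and afterwards. The work heads stay in the first `B + 1` cells,
which is enough to handle numbers below `2 ^ B`. -/
def Maps (F : Frag α K Cell E) (w : List α) (B pos : ℕ) (σ : K → ℕ) (e : E) (σ' : K → ℕ) : Prop :=
  F.Runs w (B + 1) (store σ pos) e (store σ' pos)

theorem runs_pure_store {σ : K → ℕ} {e : E} :
    (pure e : Frag α K Cell E).Runs w (B + 1) (store σ pos) e (store σ pos) :=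
  runs_pure fun _ => Nat.succ_pos _

/-- A step that writes back what it reads changes only head positions. -/
theorem act_reads {Γ : Type} (D : Memory K Γ) (i : HeadMove) (m : K → HeadMove) :
    D.act w (i, fun k => (D.tape k (D.head k), m k)) =
      ⟨OfflineTM.moveInput w D.inputPos i, D.tape,
        fun k => OfflineTM.moveWork (D.head k) (m k)⟩ := by
  simp [Memory.act]

/-- Move all work heads to the left until the head of tape `k` is in the marked cell. -/
def home (k : K) : Frag α K Cell Unit where
  Q := Unit
  entry := ()
  δ := fun _ _ r => if (r k).1 then (.inr (), .stay, fun l => (r l, .stay))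
    else (.inl (), .stay, fun l => (r l, .left))

theorem runs_home {k : K} {D : Memory K Cell} {V : ℕ} (hD : ∀ i, (D.tape k i).1 = decide (i = 0))
    (hV : D.head k < V) (hle : ∀ l, D.head l ≤ D.head k) :
    (home k : Frag α K Cell Unit).Runs w V D () { D with head := fun _ => 0 } := by
  obtain ⟨h, hh⟩ : ∃ h, D.head k = h := ⟨_, rfl⟩
  induction h generalizing D with
  | zero =>
    have h0 : D.head = fun _ => 0 := funext fun l => Nat.le_zero.1 (hh ▸ hle l)
    refine .of_next (fun l => (hle l).trans_lt hV) ?_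
    simp [next, home, hD, Memory.act, OfflineTM.moveInput, OfflineTM.moveWork, h0]
  | succ h ih =>
    have hrun := ih (D := { D with head := fun l => D.head l - 1 }) hD (by simp only; omega)
      (fun l => Nat.sub_le_sub_right (hle l) 1) (by simp only; omega)
    refine Path.trans (.of_next (fun l => (hle l).trans_lt hV) ?_) hrun
    simp [next, home, hD, hh, Memory.act, OfflineTM.moveInput, OfflineTM.moveWork]

/-- Test whether register `k` is zero. -/
def isZero (k : K) : Frag α K Cell Bool where
  Q := Unit
  entry := ()
  δ := fun _ _ r => (.inr (decide ((r k).2 = none)), .stay, fun m => (r m, .stay))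

theorem maps_isZero {σ : K → ℕ} (k : K) :
    (isZero k : Frag α K Cell Bool).Maps w B pos σ (decide (σ k = 0)) σ := by
  refine .of_next (fun _ => Nat.succ_pos _) ?_
  simp only [next, isZero, Prod.map, act_reads, id]
  simp [store, digit, OfflineTM.moveWork, OfflineTM.moveInput]

/-- Mark the leftmost cells of all work tapes. -/
def mark : Frag α K Cell Unit where
  Q := Unit
  entry := ()
  δ := fun _ _ _ => (.inr (), .stay, fun _ => ((true, none), .stay))

theorem runs_mark {V : ℕ} (hV : 0 < V) : (mark : Frag α K Cell Unit).Runs w V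
    ⟨0, fun _ _ => (false, none), fun _ => 0⟩ () (store (fun _ => 0) 0) := by
  refine .of_next (fun _ => hV) ?_
  simp only [next, mark, store, Memory.act, OfflineTM.moveInput, OfflineTM.moveWork,
    digit_zero_left, Prod.map, id, Prod.mk.injEq, Memory.mk.injEq, true_and, and_true]
  funext k i
  by_cases hi : i = 0 <;> simp [hi]

variable [DecidableEq K]

/-- The memory that differs from `store σ pos` in the tape `k`, which has content `T` and head
position `h`. -/
def withTape (σ : K → ℕ) (pos : ℕ) (k : K) (T : ℕ → Cell) (h : ℕ) : Memory K Cell where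
  inputPos := pos
  tape := Function.update (store σ pos).tape k T
  head := Function.update (fun _ => 0) k h

theorem withTape_head_lt {σ : K → ℕ} {k : K} {T : ℕ → Cell} {h V : ℕ} (hV : h < V) (l : K) :
    (withTape σ pos k T h).head l < V := by
  by_cases hl : l = k
  · subst hl
    simpa [withTape] using hV
  · simp only [withTape, Function.update_of_ne hl]
    omega

/-- The action that writes `g` on tape `k`, moves its head, and leaves the other tapes alone. -/
def onTape (k : K) (r : K → Cell) (g : Cell) (m : HeadMove) : TapeAction K Cell :=
  (.stay, Function.update (fun l => (r l, .stay)) k (g, m))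

theorem act_onTape (σ : K → ℕ) (k : K) (T : ℕ → Cell) (h : ℕ) (g : Cell) (m : HeadMove) :
    (withTape σ pos k T h).act w (onTape k (fun l => (withTape σ pos k T h).tape l
      ((withTape σ pos k T h).head l)) g m) =
    withTape σ pos k (Function.update T h g) (OfflineTM.moveWork h m) := by
  simp only [Memory.act, withTape, onTape, OfflineTM.moveInput, Memory.mk.injEq, true_and]
  constructor
  · funext l
    by_cases hl : l = k
    · subst hl
      simp
    · simp [Function.update_of_ne hl]
  · funext l
    by_cases hl : l = k
    · subst hl
      simp
    · simp [Function.update_of_ne hl, OfflineTM.moveWork]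

theorem runs_home_withTape {σ : K → ℕ} {k : K} {T : ℕ → Cell} {h v : ℕ}
    (h1 : ∀ i, (T i).1 = decide (i = 0))
    (h2 : ∀ i, (T i).2 = digit v i) (hB : h ≤ B) :
    (home k : Frag α K Cell Unit).Runs w (B + 1) (withTape σ pos k T h) ()
      (store (Function.update σ k v) pos) := by
  have := runs_home (α := α) (w := w) (V := B + 1) (k := k) (D := withTape σ pos k T h)
    (by simpa [withTape] using h1) (withTape_head_lt (by omega) k) (by
      intro l
      by_cases hl : l = k
      · rw [hl]
      · simp [withTape, Function.update_of_ne hl])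
  convert this using 1
  simp only [store, withTape, Memory.mk.injEq, true_and, and_true]
  funext l i
  by_cases hl : l = k
  · subst hl
    simp [← h1, ← h2]
  · simp [Function.update_of_ne hl]

theorem withTape_store (σ : K → ℕ) (k : K) :
    withTape σ pos k ((store σ pos).tape k) 0 = store σ pos := by
  simp only [withTape, Function.update_eq_self, store]

/-- Propagate the carry: replace digits `1` by `0` up to the first other cell, which becomes `1`. -/
def carry (k : K) : Frag α K Cell Unit where
  Q := Unit
  entry := ()
  δ := fun _ _ r => if (r k).2 = some true then (.inl (), onTape k r ((r k).1, some false) .right)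
    else (.inr (), onTape k r ((r k).1, some true) .stay)

/-- Started at position `h` of a tape whose cells from `h` on hold the digits of `v`, the fragment
`carry` replaces `v` by `v + 1`. -/
theorem runs_carry (σ : K → ℕ) (k : K) {V : ℕ} (b : ℕ) : ∀ (v h : ℕ) (T : ℕ → Cell), v < 2 ^ b →
    h + b < V → (∀ i, (T (h + i)).2 = digit v i) → ∃ T' h', h' ≤ h + b ∧
    (carry k : Frag α K Cell Unit).Runs w V (withTape σ pos k T h) () (withTape σ pos k T' h') ∧
    (∀ i, (T' i).1 = (T i).1) ∧ (∀ i < h, T' i = T i) ∧ ∀ i, (T' (h + i)).2 = digit (v + 1) i := by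
  -- an even number has no carry to propagate
  have key (v h : ℕ) (T : ℕ → Cell) (hh : h < V) (hT : ∀ i, (T (h + i)).2 = digit v i)
      (hv : v % 2 = 0) : ∃ T',
      (carry k : Frag α K Cell Unit).Runs w V (withTape σ pos k T h) () (withTape σ pos k T' h) ∧
      (∀ i, (T' i).1 = (T i).1) ∧ (∀ i < h, T' i = T i) ∧
      ∀ i, (T' (h + i)).2 = digit (v + 1) i := by
    have hT0 : (T h).2 ≠ some true := by
      have := hT 0
      rw [add_zero] at this
      rw [this, digit]
      split_ifs <;> simp [hv]
    refine ⟨Function.update T h ((T h).1, some true), .of_next (withTape_head_lt hh) ?_, ?_, ?_, ?_⟩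
    · have := act_onTape (w := w) (pos := pos) σ k T h ((T h).1, some true) .stay
      simp only [OfflineTM.moveWork] at this
      rw [← this]
      simp [next, carry, withTape, hT0]
    · intro i
      by_cases hi : i = h <;> simp [hi]
    · intro i hi
      simp [hi.ne]
    · rintro (_ | i)
      · simp [digit]
        omega
      · have : (v + 1) / 2 = v / 2 := by omega
        simp only [digit, this]
        rw [Function.update_of_ne (by omega), hT, digit]
  induction b with
  | zero =>
    intro v h T hv hh hT
    obtain ⟨T', h1⟩ := key v h T (by omega) hT (by simp at hv; simp [hv])
    exact ⟨T', h, by omega, h1⟩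
  | succ b ih =>
    intro v h T hv hh hT
    rcases Nat.mod_two_eq_zero_or_one v with h2 | h2
    · obtain ⟨T', h1⟩ := key v h T (by omega) hT h2
      exact ⟨T', h, by omega, h1⟩
    have hT0 : (T h).2 = some true := by
      have := hT 0
      rw [add_zero] at this
      rw [this, digit, if_neg (by rintro rfl; simp at h2)]
      simp [h2]
    obtain ⟨T', h', hle, hrun, hT1, hT2, hT3⟩ := ih (v / 2) (h + 1)
      (Function.update T h ((T h).1, some false)) (by rw [pow_succ] at hv; omega) (by omega) (by
        intro i
        rw [Function.update_of_ne (by omega), add_assoc, add_comm 1 i, hT, digit])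
    refine ⟨T', h', by omega, Path.trans (.of_next (withTape_head_lt (by omega)) ?_) hrun,
      ?_, ?_, ?_⟩
    · have := act_onTape (w := w) (pos := pos) σ k T h ((T h).1, some false) .right
      simp only [OfflineTM.moveWork] at this
      rw [← this]
      simp [next, carry, withTape, hT0]
    · intro i
      rw [hT1]
      by_cases hi : i = h <;> simp [hi]
    · intro i hi
      rw [hT2 i (by omega), Function.update_of_ne (by omega)]
    · rintro (_ | i)
      · rw [add_zero, hT2 h (by omega)]
        simp [digit]
        omega
      · have : (v + 1) / 2 = v / 2 + 1 := by omega
        rw [digit, this, ← hT3, add_assoc, add_comm 1 i]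

/-- Increment register `k`. -/
def inc (k : K) : Frag α K Cell Unit := (carry k).seq (home k)

theorem maps_inc {σ : K → ℕ} (k : K) (h : σ k < 2 ^ B) :
    (inc k : Frag α K Cell Unit).Maps w B pos σ () (Function.update σ k (σ k + 1)) := by
  obtain ⟨T', h', hle, hrun, h1, -, h3⟩ := runs_carry (α := α) (w := w) (pos := pos) σ k
    (V := B + 1) B (σ k) 0 ((store σ pos).tape k) h (by omega) (by simp [store])
  rw [withTape_store] at hrun
  refine hrun.seq (runs_home_withTape ?_ ?_ (by omega))
  · simpa [store] using h1
  · simpa using h3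

/-- Replace all digits from the head of tape `k` on by blanks. -/
def erase (k : K) : Frag α K Cell Unit where
  Q := Unit
  entry := ()
  δ := fun _ _ r => if (r k).2 = none then (.inr (), onTape k r (r k) .stay)
    else (.inl (), onTape k r ((r k).1, none) .right)

theorem runs_erase (σ : K → ℕ) (k : K) {V : ℕ} (b : ℕ) : ∀ (v h : ℕ) (T : ℕ → Cell), v < 2 ^ b →
    h + b < V → (∀ i, (T (h + i)).2 = digit v i) → ∃ T' h', h' ≤ h + b ∧
    (erase k : Frag α K Cell Unit).Runs w V (withTape σ pos k T h) () (withTape σ pos k T' h') ∧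
    (∀ i, (T' i).1 = (T i).1) ∧ (∀ i < h, T' i = T i) ∧ ∀ i, (T' (h + i)).2 = none := by
  have key (h : ℕ) (T : ℕ → Cell) (hh : h < V) (hT : ∀ i, (T (h + i)).2 = digit 0 i) : ∃ T',
      (erase k : Frag α K Cell Unit).Runs w V (withTape σ pos k T h) () (withTape σ pos k T' h) ∧
      (∀ i, (T' i).1 = (T i).1) ∧ (∀ i < h, T' i = T i) ∧ ∀ i, (T' (h + i)).2 = none := by
    simp only [digit_zero_left] at hT
    refine ⟨T, .of_next (withTape_head_lt hh) ?_, fun _ => rfl, fun _ _ => rfl, hT⟩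
    have := act_onTape (w := w) (pos := pos) σ k T h (T h) .stay
    simp only [OfflineTM.moveWork, Function.update_eq_self] at this
    have h0 := hT 0
    rw [add_zero] at h0
    conv_rhs => rw [← this]
    simp [next, erase, withTape, h0]
  induction b with
  | zero =>
    intro v h T hv hh hT
    obtain rfl : v = 0 := by simpa using hv
    obtain ⟨T', h1⟩ := key h T (by omega) hT
    exact ⟨T', h, by omega, h1⟩
  | succ b ih =>
    intro v h T hv hh hT
    rcases Nat.eq_zero_or_pos v with rfl | hpos
    · obtain ⟨T', h1⟩ := key h T (by omega) hT
      exact ⟨T', h, by omega, h1⟩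
    have hT0 : (T h).2 ≠ none := by
      have := hT 0
      rw [add_zero] at this
      rw [this, digit, if_neg (by omega)]
      simp
    obtain ⟨T', h', hle, hrun, hT1, hT2, hT3⟩ := ih (v / 2) (h + 1)
      (Function.update T h ((T h).1, none)) (by rw [pow_succ] at hv; omega) (by omega) (by
        intro i
        rw [Function.update_of_ne (by omega), add_assoc, add_comm 1 i, hT, digit])
    refine ⟨T', h', by omega, Path.trans (.of_next (withTape_head_lt (by omega)) ?_) hrun,
      ?_, ?_, ?_⟩
    · have := act_onTape (w := w) (pos := pos) σ k T h ((T h).1, none) .right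
      simp only [OfflineTM.moveWork] at this
      rw [← this]
      simp [next, erase, withTape, hT0]
    · intro i
      rw [hT1]
      by_cases hi : i = h <;> simp [hi]
    · intro i hi
      rw [hT2 i (by omega), Function.update_of_ne (by omega)]
    · rintro (_ | i)
      · rw [add_zero, hT2 h (by omega)]
        simp
      · rw [← hT3 i, add_assoc, add_comm 1 i]

/-- Set register `k` to zero. -/
def clear (k : K) : Frag α K Cell Unit := (erase k).seq (home k)

theorem maps_clear {σ : K → ℕ} (k : K) (h : σ k < 2 ^ B) :
    (clear k : Frag α K Cell Unit).Maps w B pos σ () (Function.update σ k 0) := by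
  obtain ⟨T', h', hle, hrun, h1, -, h3⟩ := runs_erase (α := α) (w := w) (pos := pos) σ k
    (V := B + 1) B (σ k) 0 ((store σ pos).tape k) h (by omega) (by simp [store])
  rw [withTape_store] at hrun
  refine hrun.seq (runs_home_withTape ?_ ?_ (by omega))
  · simpa [store] using h1
  · simpa [digit_zero_left] using h3

/-- Compare the digits of registers `k` and `l` up to the first difference. -/
def compare (k l : K) : Frag α K Cell Bool where
  Q := Unit
  entry := ()
  δ := fun _ _ r => if (r k).2 = (r l).2 then
      if (r k).2 = none then (.inr true, .stay, fun m => (r m, .stay))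
      else (.inl (), .stay, fun m => (r m, if m = k ∨ m = l then .right else .stay))
    else (.inr false, .stay, fun m => (r m, .stay))

/-- The memory that differs from `store σ pos` in the head position of tapes `k` and `l`. -/
def withHeads (σ : K → ℕ) (pos : ℕ) (k l : K) (h : ℕ) : Memory K Cell where
  inputPos := pos
  tape := (store σ pos).tape
  head := fun m => if m = k ∨ m = l then h else 0

theorem next_compare (σ : K → ℕ) (k l : K) (h : ℕ) :
    (compare k l : Frag α K Cell Bool).next w () (withHeads σ pos k l h) =
      if digit (σ k) h = digit (σ l) h then
        if digit (σ k) h = none then (.inr true, withHeads σ pos k l h)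
        else (.inl (), withHeads σ pos k l (h + 1))
      else (.inr false, withHeads σ pos k l h) := by
  have hk : ((withHeads σ pos k l h).tape k ((withHeads σ pos k l h).head k)).2 =
      digit (σ k) h := by
    simp [withHeads, store]
  have hl : ((withHeads σ pos k l h).tape l ((withHeads σ pos k l h).head l)).2 =
      digit (σ l) h := by
    simp [withHeads, store]
  simp only [next, compare, hk, hl]
  split_ifs
  · simp only [Prod.map, act_reads, id]
    rfl
  · simp only [Prod.map, act_reads, id, withHeads, OfflineTM.moveInput, Prod.mk.injEq,
      Memory.mk.injEq, true_and]
    funext m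
    split_ifs <;> rfl
  · simp only [Prod.map, act_reads, id]
    rfl

/-- Started at position `h` of two tapes whose cells from `h` on hold the digits of `u` and `v`, the
fragment `compare` decides whether `u = v`. -/
theorem runs_compare (σ : K → ℕ) (k l : K) {V : ℕ} (b : ℕ) : ∀ (u v h : ℕ), u < 2 ^ b → v < 2 ^ b →
    h + b < V → (∀ i, digit (σ k) (h + i) = digit u i) → (∀ i, digit (σ l) (h + i) = digit v i) →
    ∃ h' ≤ h + b, (compare k l : Frag α K Cell Bool).Runs w V
      (withHeads σ pos k l h) (decide (u = v)) (withHeads σ pos k l h') := by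
  induction b with
  | zero =>
    intro u v h hu hv hh hk hl
    obtain rfl : u = 0 := by simpa using hu
    obtain rfl : v = 0 := by simpa using hv
    refine ⟨h, by omega, .of_next (fun m => by simp only [withHeads]; split_ifs <;> omega) ?_⟩
    have h1 := hk 0
    have h2 := hl 0
    rw [add_zero, digit_zero_left] at h1 h2
    -- the only state of `compare k l` is `()` after unfolding, whence `erw`
    erw [next_compare]
    simp [h1, h2]
  | succ b ih =>
    intro u v h hu hv hh hk hl
    have h1 := hk 0
    have h2 := hl 0
    rw [add_zero] at h1 h2
    rw [pow_succ] at hu hv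
    have hV (m : K) : (withHeads σ pos k l h).head m < V := by
      simp only [withHeads]
      split_ifs <;> omega
    by_cases hd : digit u 0 = digit v 0
    · by_cases hn : digit u 0 = none
      · have h0 (v : ℕ) (hv : digit v 0 = none) : v = 0 := by
          rw [digit] at hv
          split_ifs at hv with h0
          exact h0
        refine ⟨h, by omega, .of_next hV ?_⟩
        erw [next_compare]
        simp [h1, h2, h0 u hn, h0 v (hd ▸ hn), digit_zero_left]
      · obtain ⟨h', hle, hrun⟩ := ih (u / 2) (v / 2) (h + 1) (by omega) (by omega) (by omega)
          (fun i => by rw [add_assoc, add_comm 1 i, hk, digit])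
          (fun i => by rw [add_assoc, add_comm 1 i, hl, digit])
        have huv : u / 2 = v / 2 ↔ u = v := by
          constructor
          · intro h
            simp only [digit] at hd hn
            split_ifs at hd hn with h3 h4
            all_goals simp at hd
            all_goals omega
          · rintro rfl
            rfl
        rw [decide_eq_decide.2 huv] at hrun
        refine ⟨h', by omega, Path.trans (.of_next hV ?_) hrun⟩
        erw [next_compare]
        rw [h1, h2, if_pos hd, if_neg hn]
        rfl
    · have huv : u ≠ v := fun h => hd (h ▸ rfl)
      refine ⟨h, by omega, .of_next hV ?_⟩
      erw [next_compare]
      simp [h1, h2, hd, huv]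

/-- Test whether registers `k` and `l` are equal. -/
def eq (k l : K) : Frag α K Cell Bool := (compare k l).bind fun b => (home k).seq (pure b)

theorem maps_eq {σ : K → ℕ} (k l : K) (hk : σ k < 2 ^ B) (hl : σ l < 2 ^ B) :
    (eq k l : Frag α K Cell Bool).Maps w B pos σ (decide (σ k = σ l)) σ := by
  obtain ⟨h', hle, hrun⟩ := runs_compare (α := α) (w := w) (pos := pos) σ k l (V := B + 1)
    B (σ k) (σ l) 0 hk hl (by omega) (by simp) (by simp)
  have h0 : withHeads σ pos k l 0 = store σ pos := by simp [withHeads, store]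
  rw [h0] at hrun
  refine hrun.bind (Runs.seq (runs_home (fun i => rfl) ?_ ?_) runs_pure_store)
  · simp only [withHeads, true_or, if_true]
    omega
  · intro m
    simp only [withHeads, true_or, if_true]
    split_ifs <;> omega

end Frag

namespace Frag

variable {α K E E' S : Type} {w : List α} {B pos : ℕ}

/-! ### Access to the input and loops -/

/-- Look at the cell under the input head, and let it determine the move of the input head and the
exit. -/
def input (f : InputCell α → HeadMove × E) : Frag α K Cell E where
  Q := Unit
  entry := ()
  δ := fun _ c r => (.inr (f c).2, (f c).1, fun k => (r k, .stay))

theorem runs_input (f : InputCell α → HeadMove × E) {σ : K → ℕ} :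
    (input f : Frag α K Cell E).Runs w (B + 1) (store σ pos)
      (f (OfflineTM.inputCell w pos)).2
      (store σ (OfflineTM.moveInput w pos (f (OfflineTM.inputCell w pos)).1)) := by
  refine .of_next (fun _ => Nat.succ_pos _) ?_
  simp only [next, input, Prod.map, act_reads, id]
  rfl

/-- Move the input head to the left end marker. -/
def rewind : Frag α K Cell Unit :=
  iter (fun _ : Unit => input fun
    | .leftEnd => (.stay, .inl ())
    | _ => (.left, .inr ())) ()

theorem runs_rewind {σ : K → ℕ} :
    ∀ pos, (rewind : Frag α K Cell Unit).Runs w (B + 1) (store σ pos) () (store σ 0)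
  | 0 => .iter_exit (runs_input _)
  | pos + 1 => by
    refine Runs.iter_again ?_ (runs_rewind pos)
    have := runs_input (α := α) (w := w) (B := B) (pos := pos + 1) (σ := σ) (E := Unit ⊕ Unit) fun
      | .leftEnd => (.stay, .inl ())
      | _ => (.left, .inr ())
    cases h : w[pos]? <;> simpa [OfflineTM.inputCell, h, OfflineTM.moveInput] using this

/-- Go through the letters of the input from left to right, executing `body s a` for each letter
`a`, where the finite control `s` is the exit of the previous execution. Finally return to the left
end marker. -/
def forInput [Finite α] [Finite S] (body : S → α → Frag α K Cell S) (s : S) : Frag α K Cell S :=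
  (input fun _ => (.right, ())).seq <|
    (iter (fun s => (input fun
      | .letter a => (.stay, some a)
      | _ => (.stay, none)).bind fun
      | none => pure (.inl s)
      | some a => (body s a).bind fun s' =>
          (input fun _ => (.right, ())).seq (pure (.inr s'))) s).bind fun s => rewind.seq (pure s)

/-- The functions `s` and `σ` give the finite control and the registers before each letter. -/
theorem runs_forInput [Finite α] [Finite S] {body : S → α → Frag α K Cell S} (s : ℕ → S)
    (σ : ℕ → K → ℕ) (h : ∀ i (hi : i < w.length),
      (body (s i) w[i]).Maps w B (i + 1) (σ i) (s (i + 1)) (σ (i + 1))) :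
    (forInput body (s 0)).Maps w B 0 (σ 0) (s w.length) (σ w.length) := by
  have hright (i : ℕ) (hi : i ≤ w.length) (τ : K → ℕ) :
      (input fun _ => (.right, ()) : Frag α K Cell Unit).Runs w (B + 1) (store τ i) ()
        (store τ (i + 1)) := by
    have := runs_input (α := α) (w := w) (B := B) (pos := i) (σ := τ)
      (fun _ => (HeadMove.right, ()))
    simpa [OfflineTM.moveInput, hi] using this
  refine (hright 0 (Nat.zero_le _) _).seq (Runs.bind (e := s w.length) (D' := store (σ w.length)
    (w.length + 1)) ?_ ((runs_rewind _).seq runs_pure_store))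
  -- the remaining iterations, starting with the letter at index `w.length - m`
  suffices H : ∀ m i, i + m = w.length → (iter (fun s => (input fun
      | .letter a => (.stay, some a)
      | _ => (.stay, none)).bind fun
      | none => pure (.inl s)
      | some a => (body s a).bind fun s' => (input fun _ => (.right, ())).seq (pure (.inr s')))
      (s i)).Runs w (B + 1) (store (σ i) (i + 1)) (s w.length)
        (store (σ w.length) (w.length + 1)) from H w.length 0 (zero_add _)
  intro m
  induction m with
  | zero =>
    intro i hi
    rw [add_zero] at hi
    subst hi
    refine .iter_exit (Runs.bind (e := none) ?_ runs_pure_store)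
    have := runs_input (α := α) (w := w) (B := B) (pos := w.length + 1) (σ := σ w.length) fun
      | .letter a => (HeadMove.stay, some a)
      | _ => (.stay, none)
    simpa [OfflineTM.inputCell, OfflineTM.moveInput] using this
  | succ m ih =>
    intro i hi
    have hi' : i < w.length := by omega
    refine .iter_again (Runs.bind (e := some w[i]) ?_
      ((h i hi').bind ((hright (i + 1) hi' _).seq runs_pure_store))) (ih (i + 1) (by omega))
    have := runs_input (α := α) (w := w) (B := B) (pos := i + 1) (σ := σ i) fun
      | .letter a => (HeadMove.stay, some a)
      | _ => (.stay, none)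
    simpa [OfflineTM.inputCell, OfflineTM.moveInput, hi'] using this

variable [DecidableEq K]

/-- Execute `body` for increasing values of register `j`, from its current value up to but not
including the value of register `b`. Finally clear register `j`. -/
def forLoop (j b : K) (body : Frag α K Cell Unit) : Frag α K Cell Unit :=
  (iter (fun _ : Unit => (eq j b).cond (pure (.inl ()))
    (body.seq ((inc j).seq (pure (.inr ()))))) ()).seq (clear j)

/-- The function `s` gives the registers, except for the loop counter `j`, before each execution of
the body. The body must not change the counter `j` nor the limit `b`. -/
theorem maps_forLoop {j b : K} {body : Frag α K Cell Unit} {σ σ' : K → ℕ} (s : ℕ → K → ℕ) {m n : ℕ}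
    (hσ : σ = Function.update (s m) j m) (hσ' : σ' = Function.update (s n) j 0) (hmn : m ≤ n)
    (hn : n < 2 ^ B) (hjb : b ≠ j) (hb : ∀ i, m ≤ i → i ≤ n → s i b = n)
    (h : ∀ i, m ≤ i → i < n → body.Maps w B pos (Function.update (s i) j i) ()
      (Function.update (s (i + 1)) j i)) :
    (forLoop j b body).Maps w B pos σ () σ' := by
  subst hσ hσ'
  have hcl := maps_clear (α := α) (w := w) (B := B) (pos := pos) (σ := Function.update (s n) j n) j
    (by simpa using hn)
  rw [Function.update_idem] at hcl
  refine Runs.seq ?_ hcl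
  suffices H : ∀ d i, m ≤ i → i + d = n → (iter (fun _ : Unit => (eq j b).cond (pure (.inl ()))
    (body.seq ((inc j).seq (pure (.inr ()))))) () : Frag α K Cell Unit).Runs w (B + 1)
      (store (Function.update (s i) j i) pos) () (store (Function.update (s n) j n) pos) from
    H (n - m) m le_rfl (by omega)
  intro d
  induction d with
  | zero =>
    intro i hi hin
    rw [add_zero] at hin
    subst hin
    have ht := maps_eq (α := α) (w := w) (B := B) (pos := pos) (σ := Function.update (s i) j i) j b
      (by simpa using hn) (by simpa [hjb, hb i hi le_rfl] using hn)
    rw [decide_eq_true (by simp [hjb, hb i hi le_rfl])] at ht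
    exact .iter_exit (Runs.cond_true ht runs_pure_store)
  | succ d ih =>
    intro i hi hin
    have ht := maps_eq (α := α) (w := w) (B := B) (pos := pos) (σ := Function.update (s i) j i) j b
      (by simp; omega) (by simpa [hjb, hb i hi (by omega)] using hn)
    rw [decide_eq_false (by simp [hjb, hb i hi (by omega)]; omega)] at ht
    have hinc := maps_inc (α := α) (w := w) (B := B) (pos := pos)
      (σ := Function.update (s (i + 1)) j i) j (by simp; omega)
    rw [Function.update_self, Function.update_idem] at hinc
    exact .iter_again (Runs.cond_false ht ((h i hi (by omega)).seq (hinc.seq runs_pure_store)))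
      (ih (i + 1) (by omega) (by omega))

end Frag

/-! ### Arithmetic on registers -/

/-- The registers of the machine: `p`, `c` and `n` hold the variables of the algorithm, `x` the
summation variable; `u`, `v` are used for the evaluation of one summand, `acc` for the sum; the
others are auxiliary. -/
inductive Reg where
  | p | c | n | x | u | v | acc | t | i | j | s
  deriving DecidableEq

instance : Finite Reg :=
  Finite.of_injective (fun r => (⟨r.ctorIdx, by cases r <;> decide⟩ : Fin 11)) (by
    intro r r' h
    cases r <;> cases r' <;> first | rfl | simp [Reg.ctorIdx] at h)

namespace Frag

variable {α K E E' S : Type} {w : List α} {B pos : ℕ}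

theorem Maps.congr {F : Frag α K Cell E} {σ σ₁ σ₂ : K → ℕ} {e : E} (h : F.Maps w B pos σ e σ₁)
    (hσ : σ₁ = σ₂) : F.Maps w B pos σ e σ₂ :=
  hσ ▸ h

theorem maps_pure {σ : K → ℕ} {e : E} : (pure e : Frag α K Cell E).Maps w B pos σ e σ :=
  runs_pure_store

theorem maps_pure_of_eq {σ σ' : K → ℕ} {e e' : E} (he : e' = e) (hσ : σ = σ') :
    (pure e : Frag α K Cell E).Maps w B pos σ e' σ' := by
  subst he hσ
  exact maps_pure

theorem Maps.seq {F : Frag α K Cell Unit} {G : Frag α K Cell E} {σ σ₁ σ₂ : K → ℕ} {e : E}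
    (h : F.Maps w B pos σ () σ₁) (h' : G.Maps w B pos σ₁ e σ₂) : (F.seq G).Maps w B pos σ e σ₂ :=
  Runs.seq h h'

theorem Maps.bind [Finite E] {F : Frag α K Cell E} {G : E → Frag α K Cell E'} {σ σ₁ σ₂ : K → ℕ}
    {e : E} {e' : E'} (h : F.Maps w B pos σ e σ₁) (h' : (G e).Maps w B pos σ₁ e' σ₂) :
    (F.bind G).Maps w B pos σ e' σ₂ :=
  Runs.bind h h'

theorem Maps.cond_true {F : Frag α K Cell Bool} {G H : Frag α K Cell E} {σ σ₁ σ₂ : K → ℕ} {e : E}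
    (h : F.Maps w B pos σ true σ₁) (h' : G.Maps w B pos σ₁ e σ₂) :
    (F.cond G H).Maps w B pos σ e σ₂ :=
  Runs.cond_true h h'

theorem Maps.cond_false {F : Frag α K Cell Bool} {G H : Frag α K Cell E} {σ σ₁ σ₂ : K → ℕ} {e : E}
    (h : F.Maps w B pos σ false σ₁) (h' : H.Maps w B pos σ₁ e σ₂) :
    (F.cond G H).Maps w B pos σ e σ₂ :=
  Runs.cond_false h h'

theorem maps_isZero_true {σ : K → ℕ} {k : K} (h : σ k = 0) :
    (isZero k : Frag α K Cell Bool).Maps w B pos σ true σ := by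
  have := maps_isZero (α := α) (w := w) (B := B) (pos := pos) (σ := σ) k
  rwa [decide_eq_true h] at this

theorem maps_isZero_false {σ : K → ℕ} {k : K} (h : σ k ≠ 0) :
    (isZero k : Frag α K Cell Bool).Maps w B pos σ false σ := by
  have := maps_isZero (α := α) (w := w) (B := B) (pos := pos) (σ := σ) k
  rwa [decide_eq_false h] at this

section

variable [DecidableEq K]

theorem maps_eq_true {σ : K → ℕ} {k l : K} (hk : σ k < 2 ^ B) (h : σ k = σ l) :
    (eq k l : Frag α K Cell Bool).Maps w B pos σ true σ := by
  have := maps_eq (α := α) (w := w) (pos := pos) k l hk (h ▸ hk)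
  rwa [decide_eq_true h] at this

theorem maps_eq_false {σ : K → ℕ} {k l : K} (hk : σ k < 2 ^ B) (hl : σ l < 2 ^ B) (h : σ k ≠ σ l) :
    (eq k l : Frag α K Cell Bool).Maps w B pos σ false σ := by
  have := maps_eq (α := α) (w := w) (pos := pos) k l hk hl
  rwa [decide_eq_false h] at this

/-- Increment register `a` modulo register `p`. -/
def incMod (p a : K) : Frag α K Cell Unit := (inc a).seq ((eq a p).cond (clear a) (pure ()))

theorem maps_incMod {σ : K → ℕ} {p a : K} (hpa : p ≠ a) (ha : σ a < σ p) (hp : σ p < 2 ^ B) :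
    (incMod p a : Frag α K Cell Unit).Maps w B pos σ ()
      (Function.update σ a ((σ a + 1) % σ p)) := by
  refine Maps.seq (maps_inc a (ha.trans hp)) ?_
  by_cases h : σ a + 1 = σ p
  · refine Maps.cond_true (maps_eq_true (by simp; omega) (by simp [hpa, h]))
      (Maps.congr (maps_clear a (by simp; omega)) ?_)
    simp [h]
  · refine Maps.cond_false (maps_eq_false (by simp; omega) (by simpa [hpa] using hp)
      (by simpa [hpa] using h)) (Maps.congr maps_pure ?_)
    rw [Nat.mod_eq_of_lt (by omega)]

/-- Add register `b` to register `a` modulo register `p`, with loop counter `j`. -/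
def addMod (p j a b : K) : Frag α K Cell Unit := forLoop j b (incMod p a)

theorem maps_addMod {σ : K → ℕ} {p j a b : K} (hpa : p ≠ a) (hpj : p ≠ j) (hab : a ≠ b)
    (haj : a ≠ j) (hbj : b ≠ j) (ha : σ a < σ p) (hp : σ p < 2 ^ B) (hb : σ b < 2 ^ B)
    (hj : σ j = 0) : (addMod p j a b : Frag α K Cell Unit).Maps w B pos σ ()
      (Function.update σ a ((σ a + σ b) % σ p)) := by
  refine maps_forLoop (fun i => Function.update σ a ((σ a + i) % σ p)) (m := 0) (n := σ b)
    ?_ ?_ (Nat.zero_le _) hb hbj (fun i _ _ => by simp [hab.symm]) ?_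
  · simp only [add_zero, Nat.mod_eq_of_lt ha, Function.update_eq_self]
    rw [← hj, Function.update_eq_self]
  · rw [Function.update_comm haj, ← hj, Function.update_eq_self]
  · intro i _ _
    refine Maps.congr (maps_incMod hpa ?_ ?_) ?_
    · simp only [Function.update_of_ne haj, Function.update_self, Function.update_of_ne hpj,
        Function.update_of_ne hpa]
      exact Nat.mod_lt _ (by omega)
    · simpa [hpa, hpj] using hp
    · simp only [Function.update_of_ne haj, Function.update_self, Function.update_of_ne hpj,
        Function.update_of_ne hpa, Nat.mod_add_mod]
      rw [Function.update_comm haj, Function.update_idem, add_assoc, Function.update_comm haj]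

end

variable {σ : Reg → ℕ}

/-- Multiply register `u` by register `x` modulo register `p`. -/
def mulX : Frag α Reg Cell Unit :=
  (forLoop .i .x (addMod .p .j .t .u)).seq <| (clear .u).seq <| (addMod .p .j .u .t).seq (clear .t)

theorem maps_mulX (hu : σ .u < σ .p) (hp : σ .p < 2 ^ B) (hx : σ .x < 2 ^ B)
    (ht : σ .t = 0) (hi : σ .i = 0) (hj : σ .j = 0) :
    (mulX : Frag α Reg Cell Unit).Maps w B pos σ ()
      (Function.update σ .u (σ .u * σ .x % σ .p)) := by
  have hp0 : 0 < σ .p := by omega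
  have hlt (m : ℕ) : m % σ .p < 2 ^ B := (Nat.mod_lt _ hp0).trans hp
  refine Maps.congr (Maps.seq (maps_forLoop
    (fun m => Function.update σ .t (σ .u * m % σ .p)) (m := 0) (n := σ .x)
    (σ' := Function.update σ .t (σ .u * σ .x % σ .p)) ?_ ?_ (Nat.zero_le _) hx
    (by decide) (fun i _ _ => by simp) ?_)
    (Maps.seq (maps_clear Reg.u ?_) (Maps.seq (maps_addMod ?_ ?_ ?_ ?_ ?_ ?_ ?_ ?_ ?_)
      (maps_clear Reg.t ?_)))) ?_
  · funext k; cases k <;> simp [ht, hi]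
  · funext k; cases k <;> simp [hi]
  · intro m _ _
    refine Maps.congr (maps_addMod (by decide) (by decide) (by decide) (by decide) (by decide)
      ?_ ?_ ?_ ?_) ?_
    · simpa using Nat.mod_lt _ hp0
    · simpa
    · simp; omega
    · simpa
    · funext k; cases k <;> simp [mul_add]
  · simp; omega
  · decide
  · decide
  · decide
  · decide
  · decide
  · simpa
  · simpa
  · simpa using hlt _
  · simpa
  · simpa using hlt _
  · funext k; cases k <;> simp [ht]

/-- Divide register `u` by register `x` modulo the prime in register `p`: multiply `p - 2` times
by `x`. -/
def divX : Frag α Reg Cell Unit := (inc .s).seq <| (inc .s).seq (forLoop .s .p mulX)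

theorem maps_divX (h2 : 2 ≤ σ .p) (hu : σ .u < σ .p) (hp : σ .p < 2 ^ B) (hx : σ .x < 2 ^ B)
    (ht : σ .t = 0) (hi : σ .i = 0) (hj : σ .j = 0) (hs : σ .s = 0) :
    (divX : Frag α Reg Cell Unit).Maps w B pos σ ()
      (Function.update σ .u (σ .u * σ .x ^ (σ .p - 2) % σ .p)) := by
  refine Maps.seq (maps_inc Reg.s (by omega))
    (Maps.seq (maps_inc Reg.s (by simp; omega)) (maps_forLoop
    (fun m => Function.update σ .u (σ .u * σ .x ^ (m - 2) % σ .p)) (m := 2) (n := σ .p) ?_ ?_ h2 hp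
    (by decide) (fun i _ _ => by simp) ?_))
  · funext k; cases k <;> simp [hs, Nat.mod_eq_of_lt hu]
  · funext k; cases k <;> simp [hs]
  · intro m hm _
    refine Maps.congr (maps_mulX ?_ ?_ ?_ ?_ ?_ ?_) ?_
    · simpa using Nat.mod_lt _ (by omega)
    · simpa
    · simpa
    · simpa
    · simpa
    · simpa
    · have hm2 : m + 1 - 2 = m - 2 + 1 := by omega
      funext k; cases k <;> simp [hm2, pow_succ, mul_assoc]

/-- Count the divisors of register `p` between `2` and `p - 1` in register `acc`; leave through exit
`true` if there are none. -/
def primeTest : Frag α Reg Cell Bool :=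
  (inc .i).seq <| (inc .i).seq <| (forLoop .i .p <|
    (forLoop .j .p (incMod .i .t)).seq <|
      ((isZero .t).cond (inc .acc) (pure ())).seq (clear .t)).seq <|
  (isZero .acc).bind fun b => (clear .acc).seq (pure b)

theorem maps_primeTest (h2 : 2 ≤ σ .p) (hp : σ .p < 2 ^ B) (ht : σ .t = 0) (hi : σ .i = 0)
    (hj : σ .j = 0) (hacc : σ .acc = 0) :
    (primeTest : Frag α Reg Cell Bool).Maps w B pos σ (decide (σ .p).Prime) σ := by
  set f : ℕ → ℕ := fun m => ((Finset.Ico 2 m).filter (· ∣ σ .p)).card with hf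
  have hfle (m : ℕ) : f m ≤ m - 2 := (Finset.card_filter_le _ _).trans (by simp)
  have hf2 : f 2 = 0 := by simp [hf]
  have hfs (m : ℕ) (hm : 2 ≤ m) : f (m + 1) = if m ∣ σ .p then f m + 1 else f m := by
    simp only [hf]
    rw [← Finset.insert_Ico_right_eq_Ico_add_one hm, Finset.filter_insert]
    split_ifs
    · rw [Finset.card_insert_of_notMem (by simp)]
    · rfl
  have hprime : (σ .p).Prime ↔ f (σ .p) = 0 := by
    simp only [hf, Finset.card_eq_zero, Finset.filter_eq_empty_iff, Finset.mem_Ico]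
    rw [Nat.prime_def_lt']
    constructor
    · intro h m hm
      exact h.2 m hm.1 hm.2
    · intro h
      exact ⟨h2, fun m h3 h4 => h ⟨h3, h4⟩⟩
  refine Maps.seq (maps_inc Reg.i (by omega))
    (Maps.seq (maps_inc Reg.i (by simp; omega)) (Maps.seq (maps_forLoop
    (fun m => Function.update σ .acc (f m)) (m := 2) (n := σ .p)
    (σ' := Function.update σ .acc (f (σ .p))) ?_ ?_ h2 hp (by decide) (fun i _ _ => by simp) ?_)
    (Maps.bind (maps_isZero Reg.acc) (Maps.seq (maps_clear Reg.acc ?_) (maps_pure_of_eq ?_ ?_)))))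
  · funext k; cases k <;> simp [hi, hf2, hacc]
  · funext k; cases k <;> simp [hi]
  · intro m hm hmp
    -- register `t` counts up to `p` modulo the trial divisor `m`
    have hinner : (forLoop .j .p (incMod .i .t) : Frag α Reg Cell Unit).Maps w B pos
        (Function.update (Function.update σ .acc (f m)) .i m) ()
        (Function.update (Function.update (Function.update σ .acc (f m)) .i m) .t (σ .p % m)) := by
      refine maps_forLoop (fun l => Function.update
        (Function.update (Function.update σ .acc (f m)) .i m) .t (l % m)) (m := 0) (n := σ .p)
        ?_ ?_ (Nat.zero_le _) hp (by decide) (fun i _ _ => by simp) ?_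
      · funext k; cases k <;> simp [hj, ht]
      · funext k; cases k <;> simp [hj]
      · intro l _ _
        refine Maps.congr (maps_incMod (by decide) ?_ ?_) ?_
        · simpa using Nat.mod_lt _ (by omega)
        · simp; omega
        · funext k; cases k <;> simp
    refine Maps.seq hinner (Maps.seq (σ₁ := Function.update (Function.update (Function.update σ
      .acc (f (m + 1))) .i m) .t (σ .p % m)) ?_ (Maps.congr (maps_clear Reg.t ?_) ?_))
    · have := hfle m
      by_cases hd : m ∣ σ .p
      · refine Maps.cond_true (maps_isZero_true ?_) (Maps.congr (maps_inc Reg.acc ?_) ?_)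
        · simpa using Nat.mod_eq_zero_of_dvd hd
        · simp; omega
        · funext k; cases k <;> simp [hfs m hm, hd]
      · refine Maps.cond_false (maps_isZero_false ?_) (Maps.congr maps_pure ?_)
        · simpa using fun h => hd (Nat.dvd_of_mod_eq_zero h)
        · funext k; cases k <;> simp [hfs m hm, hd]
    · simpa using (Nat.mod_lt _ (by omega)).trans (hmp.trans hp)
    · funext k; cases k <;> simp [ht]
  · have := hfle (σ .p)
    simp; omega
  · simp [hprime]
  · funext k; cases k <;> simp [hacc]

/-- Increment register `p` until it is prime. -/
def toNextPrime : Frag α Reg Cell Unit :=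
  iter (fun _ : Unit => (inc .p).seq (primeTest.cond (pure (.inl ())) (pure (.inr ())))) ()

theorem maps_toNextPrime (h1 : 1 ≤ σ .p) (hp : (nextPrime (σ .p) : ℕ) < 2 ^ B) (ht : σ .t = 0)
    (hi : σ .i = 0) (hj : σ .j = 0) (hacc : σ .acc = 0) :
    (toNextPrime : Frag α Reg Cell Unit).Maps w B pos σ ()
      (Function.update σ .p (nextPrime (σ .p))) := by
  obtain ⟨d, hd⟩ : ∃ d, σ .p + d + 1 = nextPrime (σ .p) :=
    ⟨nextPrime (σ .p) - σ .p - 1, by have := lt_nextPrime (σ .p); omega⟩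
  induction d generalizing σ with
  | zero =>
    refine .iter_exit (Maps.seq (maps_inc Reg.p (by omega)) (Maps.cond_true (σ₁ :=
      Function.update σ .p (σ .p + 1)) ?_ (Maps.congr maps_pure ?_)))
    · have := maps_primeTest (α := α) (w := w) (B := B) (pos := pos)
        (σ := Function.update σ .p (σ .p + 1)) (by simpa using h1) (by simp; omega) (by simpa)
        (by simpa) (by simpa) (by simpa)
      rwa [decide_eq_true] at this
      rw [Function.update_self]
      rw [add_zero] at hd
      rw [hd]
      exact (nextPrime (σ .p)).2
    · rw [← hd, add_zero]
  | succ d ih =>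
    have hnp : ¬ (σ .p + 1).Prime := fun h => by
      have := nextPrime_le h (Nat.lt_succ_self _)
      omega
    have hnext : (nextPrime (σ .p + 1) : ℕ) = nextPrime (σ .p) := by
      apply le_antisymm
      · exact nextPrime_le (nextPrime (σ .p)).2 (by omega)
      · exact nextPrime_le (nextPrime (σ .p + 1)).2
          ((Nat.lt_succ_self _).trans (lt_nextPrime (σ .p + 1)))
    have := ih (σ := Function.update σ .p (σ .p + 1)) (by simp) (by simpa [hnext])
      (by simpa) (by simpa) (by simpa) (by simpa) (by simp [hnext]; omega)
    refine .iter_again (Maps.seq (maps_inc Reg.p (by omega)) (Maps.cond_false (σ₁ :=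
      Function.update σ .p (σ .p + 1)) ?_ maps_pure)) (Maps.congr this ?_)
    · have := maps_primeTest (α := α) (w := w) (B := B) (pos := pos)
        (σ := Function.update σ .p (σ .p + 1)) (by simpa using h1) (by simp; omega) (by simpa)
        (by simpa) (by simpa) (by simpa)
      rwa [decide_eq_false (by simpa)] at this
    · simp [hnext]

/-- Add `⌊log₂ p⌋` to register `c`: while register `i` counts up to `p`, register `t` holds the
number below the next power of two. -/
def addLog : Frag α Reg Cell Unit :=
  (inc .t).seq <| (inc .i).seq <| (forLoop .i .p <| (eq .i .t).cond
    ((inc .c).seq <| (forLoop .j .i (inc .t)).seq (inc .t)) (pure ())).seq (clear .t)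

/-- Register `t` is `2 ^ (⌊log₂ i⌋ + 1) - 1`, so it equals `i` exactly when `⌊log₂ (i + 1)⌋` is
larger than `⌊log₂ i⌋`. -/
theorem maps_addLog (h1 : 1 ≤ σ .p) (hp : 2 * σ .p < 2 ^ B) (hc : σ .c + σ .p < 2 ^ B)
    (ht : σ .t = 0) (hi : σ .i = 0) (hj : σ .j = 0) :
    (addLog : Frag α Reg Cell Unit).Maps w B pos σ ()
      (Function.update σ .c (σ .c + Nat.log 2 (σ .p))) := by
  have hpow (m : ℕ) (hm : 1 ≤ m) : 2 ^ Nat.log 2 m ≤ m ∧ m < 2 ^ (Nat.log 2 m + 1) :=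
    ⟨Nat.pow_log_le_self 2 (by omega), Nat.lt_pow_succ_log_self (by norm_num) m⟩
  have hlogle := Nat.log_le_self 2
  have hsucc (m : ℕ) (hm : 1 ≤ m) : Nat.log 2 (m + 1) =
      if m = 2 ^ (Nat.log 2 m + 1) - 1 then Nat.log 2 m + 1 else Nat.log 2 m := by
    have := hpow m hm
    split_ifs with h
    · rw [Nat.log_eq_iff (by omega)]
      constructor
      · omega
      · rw [pow_succ]
        omega
    · rw [Nat.log_eq_iff (by omega)]
      constructor <;> omega
  refine Maps.seq (maps_inc Reg.t (by omega))
    (Maps.seq (maps_inc Reg.i (by simp; omega)) (Maps.seq (maps_forLoop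
    (fun m => Function.update (Function.update σ .c (σ .c + Nat.log 2 m)) .t
      (2 ^ (Nat.log 2 m + 1) - 1)) (m := 1) (n := σ .p)
    (σ' := Function.update (Function.update σ .c (σ .c + Nat.log 2 (σ .p))) .t
      (2 ^ (Nat.log 2 (σ .p) + 1) - 1)) ?_ ?_ h1 (by omega) (by decide) (fun i _ _ => by simp) ?_)
    (Maps.congr (maps_clear Reg.t ?_) ?_)))
  · funext k; cases k <;> simp [ht, hi]
  · funext k; cases k <;> simp [hi]
  · intro m hm hmp
    have hm' := hpow m hm
    have := hlogle m
    rw [pow_succ] at hm'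
    by_cases h : m = 2 ^ (Nat.log 2 m + 1) - 1
    · have hl : Nat.log 2 (m + 1) = Nat.log 2 m + 1 := by rw [hsucc m hm, if_pos h]
      refine Maps.cond_true (maps_eq_true (by simp; omega) (by simpa using h))
        (Maps.seq (maps_inc Reg.c (by simp; omega)) (Maps.seq (maps_forLoop
          (fun l => Function.update (Function.update (Function.update σ .c (σ .c + Nat.log 2 m + 1))
            .t (m + l)) .i m) (m := 0) (n := m) (σ' := Function.update (Function.update
            (Function.update σ .c (σ .c + Nat.log 2 m + 1)) .t (m + m)) .i m) ?_ ?_ (Nat.zero_le _)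
          (by omega) (by decide) (fun i _ _ => by simp) ?_)
          (Maps.congr (maps_inc Reg.t (by simp; omega)) ?_)))
      · funext k; cases k <;> simp [hj, ← h]
      · funext k; cases k <;> simp [hj]
      · intro l _ _
        refine Maps.congr (maps_inc Reg.t (by simp; omega)) ?_
        funext k; cases k <;> simp [add_assoc]
      · have : m + m + 1 = 2 ^ (Nat.log 2 m + 1 + 1) - 1 := by
          rw [pow_succ]
          omega
        funext k; cases k <;> simp [hl, this, add_assoc]
    · have hl : Nat.log 2 (m + 1) = Nat.log 2 m := by rw [hsucc m hm, if_neg h]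
      refine Maps.cond_false (maps_eq_false (by simp; omega) (by simp [pow_succ]; omega)
        (by simpa using h)) (Maps.congr maps_pure ?_)
      rw [hl]
  · have := hpow (σ .p) h1
    simp [pow_succ] at this ⊢
    omega
  · funext k; cases k <;> simp [ht]

/-- Test `c ≤ n`: register `acc` becomes `1` if `n` occurs among the numbers below `c`. -/
def leTest : Frag α Reg Cell Bool :=
  (forLoop .t .c ((eq .t .n).cond (inc .acc) (pure ()))).seq <|
    (isZero .acc).bind fun b => (clear .acc).seq (pure b)

theorem maps_leTest (hc : σ .c < 2 ^ B) (hn : σ .n < 2 ^ B) (h2 : 2 ≤ 2 ^ B) (ht : σ .t = 0)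
    (hacc : σ .acc = 0) :
    (leTest : Frag α Reg Cell Bool).Maps w B pos σ (decide (σ .c ≤ σ .n)) σ := by
  refine Maps.seq (maps_forLoop (fun m => Function.update σ .acc (if σ .n < m then 1 else 0))
    (m := 0) (n := σ .c) (σ' := Function.update σ .acc (if σ .n < σ .c then 1 else 0)) ?_ ?_
    (Nat.zero_le _) hc (by decide) (fun i _ _ => by simp) ?_)
    (Maps.bind (maps_isZero Reg.acc) (Maps.seq (maps_clear Reg.acc ?_) (maps_pure_of_eq ?_ ?_)))
  · funext k; cases k <;> simp [ht, hacc]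
  · funext k; cases k <;> simp [ht]
  · intro m _ _
    by_cases h : m = σ .n
    · refine Maps.cond_true (maps_eq_true (by simp; omega) (by simpa using h))
        (Maps.congr (maps_inc Reg.acc ?_) ?_)
      · simp [h]
      · funext k; cases k <;> simp [h]
    · refine Maps.cond_false (maps_eq_false (by simp; omega) (by simpa) (by simpa using h))
        (Maps.congr maps_pure ?_)
      have : σ .n < m + 1 ↔ σ .n < m := by omega
      simp only [this]
  · simp only [Function.update_self]
    split_ifs <;> omega
  · simp
  · funext k; cases k <;> simp [hacc]

end Frag

/-! ### Evaluation of the power sum -/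

/-- The effect of one letter on the evaluation of a summand modulo `p`. The two flags tell whether
the first integer is still being read, and whether a minus sign has been read in the current
integer. While an integer `m` is being read, `v` is the product of the preceding factors (initially
`0`) and `u` runs from `v` (initially `1`) to `v * x ^ m`, or to `v * x ^ (-m)` for the first
integer. -/
def scanStep (p x : ℕ) : (Bool × Bool) × ℕ × ℕ → UnarySymbol → (Bool × Bool) × ℕ × ℕ
  | ((f, _), u, v), .minus => ((f, true), u, v)
  | ((f, g), u, v), .one => ((f, g), (if f = g then u * x % p else u * x ^ (p - 2) % p), v)
  | (_, u, v), .sep => ((false, false), (v + u) % p, (v + u) % p)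

/-- The state of the evaluation after reading `w`. -/
def scanWord (p x : ℕ) (w : List UnarySymbol) : (Bool × Bool) × ℕ × ℕ :=
  w.foldl (scanStep p x) ((true, false), 1, 0)

theorem scanWord_lt {p x : ℕ} (hp : 2 ≤ p) (w : List UnarySymbol) :
    (scanWord p x w).2.1 < p ∧ (scanWord p x w).2.2 < p := by
  have hmod (a : ℕ) : a % p < p := Nat.mod_lt _ (by omega)
  induction w using List.reverseRecOn with
  | nil => exact ⟨by simp [scanWord]; omega, by simp [scanWord]; omega⟩
  | append_singleton w a ih =>
    rw [scanWord, List.foldl_append, ← scanWord]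
    generalize scanWord p x w = S at ih ⊢
    obtain ⟨⟨f, g⟩, u, v⟩ := S
    cases a with
    | one =>
      refine ⟨?_, ih.2⟩
      simp only [List.foldl, scanStep]
      split_ifs <;> exact hmod _
    | minus => exact ih
    | sep => exact ⟨hmod _, hmod _⟩

section Field

variable {p x : ℕ} [Fact p.Prime]

theorem ZMod.pow_sub_two (hx : (x : ZMod p) ≠ 0) : (x : ZMod p) ^ (p - 2) = (x : ZMod p)⁻¹ := by
  have h2 := (Fact.out : p.Prime).two_le
  refine eq_inv_of_mul_eq_one_left ?_
  rw [← pow_succ, show p - 2 + 1 = p - 1 by omega]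
  exact ZMod.pow_card_sub_one_eq_one hx

theorem scan_replicate_one (hx : (x : ZMod p) ≠ 0) (f g : Bool) (v : ℕ) (k : ℕ) :
    ∀ u : ℕ, ∃ u' : ℕ, (List.replicate k UnarySymbol.one).foldl (scanStep p x) ((f, g), u, v) =
      ((f, g), u', v) ∧ (u' : ZMod p) = u * (x : ZMod p) ^ (if f = g then (k : ℤ) else -k) := by
  induction k with
  | zero => exact fun u => ⟨u, rfl, by simp⟩
  | succ k ih =>
    intro u
    obtain ⟨u', h1, h2⟩ := ih (if f = g then u * x % p else u * x ^ (p - 2) % p)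
    refine ⟨u', ?_, ?_⟩
    · rw [List.replicate_succ, List.foldl_cons, ← h1]
      rfl
    · rw [h2]
      split_ifs
      · simp only [ZMod.natCast_mod, Nat.cast_mul, Nat.cast_succ, zpow_add₀ hx, zpow_one]
        ring
      · simp only [ZMod.natCast_mod, Nat.cast_mul, Nat.cast_pow, ZMod.pow_sub_two hx, Nat.cast_succ,
          neg_add, zpow_add₀ hx, zpow_neg_one]
        ring

theorem scan_unaryInt (hx : (x : ZMod p) ≠ 0) (f : Bool) (u v : ℕ) (z : ℤ) :
    ∃ v' : ℕ, (unaryInt z).foldl (scanStep p x) ((f, false), u, v) = ((false, false), v', v') ∧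
      (v' : ZMod p) = v + u * (x : ZMod p) ^ (if f then -z else z) := by
  obtain ⟨u', h1, h2⟩ := scan_replicate_one hx f (decide (z < 0)) v z.natAbs u
  refine ⟨(v + u') % p, ?_, ?_⟩
  · rw [unaryInt, List.foldl_append, List.foldl_append]
    have : (if z < 0 then [UnarySymbol.minus] else []).foldl (scanStep p x) ((f, false), u, v) =
        ((f, decide (z < 0)), u, v) := by
      split_ifs with h <;> simp [h, scanStep]
    rw [this, h1]
    rfl
  · rw [ZMod.natCast_mod, Nat.cast_add, h2]
    congr 3
    rcases lt_or_ge z 0 with h | h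
    · cases f <;> simp [h, abs_of_neg h]
    · cases f <;> simp [not_lt.2 h, abs_of_nonneg h]

theorem scan_unaryInts (hx : (x : ZMod p) ≠ 0) (l : List ℤ) : ∀ v : ℕ,
    ∃ v' : ℕ, (l.flatMap unaryInt).foldl (scanStep p x) ((false, false), v, v) =
      ((false, false), v', v') ∧
      (v' : ZMod p) = v * (l.map fun z => 1 + (x : ZMod p) ^ z).prod := by
  induction l with
  | nil => exact fun v => ⟨v, rfl, by simp⟩
  | cons z l ih =>
    intro v
    obtain ⟨v₁, h1, h2⟩ := scan_unaryInt hx false v v z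
    obtain ⟨v', h3, h4⟩ := ih v₁
    refine ⟨v', ?_, ?_⟩
    · rw [List.flatMap_cons, List.foldl_append, h1, h3]
    · rw [h4, h2]
      simp
      ring

theorem scanWord_encode (I : SubsetSum) (hx : (x : ZMod p) ≠ 0) :
    ((scanWord p x I.encode).2.2 : ZMod p) =
      (x : ZMod p) ^ (-I.B) * ∏ i, (1 + (x : ZMod p) ^ (I.m i)) := by
  obtain ⟨v₁, h1, h2⟩ := scan_unaryInt hx true 1 0 I.B
  obtain ⟨v', h3, h4⟩ := scan_unaryInts hx (List.ofFn I.m) v₁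
  rw [scanWord, SubsetSum.encode, List.foldl_append, h1, h3, h4, h2]
  simp [List.map_ofFn, List.prod_ofFn]

/-- The sum of the evaluations is the power sum of the algorithm. -/
theorem sum_scanWord_mod_eq_zero_iff (I : SubsetSum) :
    (∑ x ∈ Finset.Ico 1 p, (scanWord p x I.encode).2.2) % p = 0 ↔ I.powerSum p = 0 := by
  rw [← Nat.dvd_iff_mod_eq_zero, ← ZMod.natCast_eq_zero_iff, SubsetSum.powerSum, Nat.cast_sum]
  have h2 := (Fact.out : p.Prime).two_le
  have : Finset.Ico 1 p = Finset.Icc 1 (p - 1) := by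
    ext
    simp only [Finset.mem_Ico, Finset.mem_Icc]
    omega
  rw [this, Finset.sum_congr rfl]
  intro x hx
  rw [Finset.mem_Icc] at hx
  refine scanWord_encode I ?_
  rw [Ne, ZMod.natCast_eq_zero_iff]
  exact Nat.not_dvd_of_pos_of_lt (by omega) (by omega)

end Field

namespace Frag

variable {w : List UnarySymbol} {B pos : ℕ} {σ : Reg → ℕ}

/-- Carry out `scanStep` on registers `u` and `v`. -/
def scanBody : Bool × Bool → UnarySymbol → Frag UnarySymbol Reg Cell (Bool × Bool)
  | (f, _), .minus => pure (f, true)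
  | (f, g), .one => (if f = g then mulX else divX).seq (pure (f, g))
  | _, .sep => (addMod .p .j .v .u).seq <| (clear .u).seq <|
      (addMod .p .j .u .v).seq (pure (false, false))

theorem maps_scanBody (h2 : 2 ≤ σ .p) (hp : σ .p < 2 ^ B) (hx : σ .x < 2 ^ B)
    (ht : σ .t = 0) (hi : σ .i = 0) (hj : σ .j = 0) (hs : σ .s = 0)
    (S : (Bool × Bool) × ℕ × ℕ) (hu : S.2.1 < σ .p) (hv : S.2.2 < σ .p) (a : UnarySymbol) :
    (scanBody S.1 a).Maps w B pos (Function.update (Function.update σ .u S.2.1) .v S.2.2)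
      (scanStep (σ .p) (σ .x) S a).1
      (Function.update (Function.update σ .u (scanStep (σ .p) (σ .x) S a).2.1) .v
        (scanStep (σ .p) (σ .x) S a).2.2) := by
  obtain ⟨⟨f, g⟩, u, v⟩ := S
  simp only at hu hv
  cases a with
  | minus => exact maps_pure
  | one =>
    by_cases hfg : f = g
    · simp only [scanBody, scanStep, hfg, if_true]
      refine Maps.seq (Maps.congr (maps_mulX ?_ ?_ ?_ ?_ ?_ ?_) ?_) maps_pure
      · simpa
      · simpa
      · simpa
      · simpa
      · simpa
      · simpa
      · funext k; cases k <;> simp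
    · simp only [scanBody, scanStep, hfg, if_false]
      refine Maps.seq (Maps.congr (maps_divX ?_ ?_ ?_ ?_ ?_ ?_ ?_ ?_) ?_) maps_pure
      · simpa
      · simpa
      · simpa
      · simpa
      · simpa
      · simpa
      · simpa
      · simpa
      · funext k; cases k <;> simp
  | sep =>
    have hmod : (v + u) % σ .p < σ .p := Nat.mod_lt _ (by omega)
    refine Maps.seq (maps_addMod (by decide) (by decide) (by decide) (by decide) (by decide)
        ?_ ?_ ?_ ?_) (Maps.seq (maps_clear Reg.u ?_) (Maps.seq (maps_addMod (by decide) (by decide)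
        (by decide) (by decide) (by decide) ?_ ?_ ?_ ?_) (maps_pure_of_eq rfl ?_)))
    · simpa
    · simpa
    · simp; omega
    · simpa
    · simp; omega
    · simp; omega
    · simpa
    · simpa using hmod.trans hp
    · simpa
    · funext k; cases k <;> simp [scanStep]

/-- Add the summand for the value of register `x` to register `acc`. -/
def addSummand : Frag UnarySymbol Reg Cell Unit :=
  (inc .u).seq <| (forInput scanBody (true, false)).bind fun _ =>
    (clear .u).seq <| (addMod .p .j .acc .v).seq (clear .v)

theorem maps_addSummand (h2 : 2 ≤ σ .p) (hp : σ .p < 2 ^ B) (hx : σ .x < 2 ^ B)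
    (ht : σ .t = 0) (hi : σ .i = 0) (hj : σ .j = 0) (hs : σ .s = 0) (hu : σ .u = 0)
    (hv : σ .v = 0) (hacc : σ .acc < σ .p) :
    addSummand.Maps w B 0 σ () (Function.update σ .acc
      ((σ .acc + (scanWord (σ .p) (σ .x) w).2.2) % σ .p)) := by
  have hlt (i : ℕ) := scanWord_lt (x := σ .x) h2 (w.take i)
  -- before the letter at index `i`, the registers `u` and `v` reflect the evaluation of `w.take i`
  have hin := runs_forInput (w := w) (B := B) (body := scanBody)
    (fun i => (scanWord (σ .p) (σ .x) (w.take i)).1)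
    (fun i => Function.update (Function.update σ .u (scanWord (σ .p) (σ .x) (w.take i)).2.1) .v
      (scanWord (σ .p) (σ .x) (w.take i)).2.2) (by
      intro i hi'
      have hstep : scanWord (σ .p) (σ .x) (w.take (i + 1)) =
          scanStep (σ .p) (σ .x) (scanWord (σ .p) (σ .x) (w.take i)) w[i] := by
        rw [scanWord, List.take_succ_eq_append_getElem hi', List.foldl_append]
        rfl
      simp only [hstep]
      exact maps_scanBody h2 hp hx ht hi hj hs _ (hlt i).1 (hlt i).2 _)
  rw [List.take_length] at hin
  have hlt := scanWord_lt (x := σ .x) h2 w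
  have hlt' := hlt.2.trans hp
  refine Maps.seq (maps_inc Reg.u (by omega)) (Maps.bind (F := forInput scanBody (true, false))
    (e := (scanWord (σ .p) (σ .x) w).1) (σ₁ := Function.update (Function.update σ .u
      (scanWord (σ .p) (σ .x) w).2.1) .v (scanWord (σ .p) (σ .x) w).2.2) ?_
    (Maps.seq (maps_clear Reg.u ?_) (Maps.seq (maps_addMod (by decide) (by decide)
        (by decide) (by decide) (by decide) ?_ ?_ ?_ ?_) (Maps.congr (maps_clear Reg.v ?_) ?_))))
  · convert hin using 1
    · rfl
    · funext k; cases k <;> simp [scanWord, hu, hv]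
  · simp; omega
  · simpa
  · simpa
  · simpa using hlt'
  · simpa
  · simpa using hlt'
  · funext k; cases k <;> simp [hu, hv]

/-- Test whether the power sum vanishes modulo `p`. -/
def powerSumTest : Frag UnarySymbol Reg Cell Bool :=
  (inc .x).seq <| (forLoop .x .p addSummand).seq <|
    (isZero .acc).bind fun b => (clear .acc).seq (pure b)

theorem maps_powerSumTest (h2 : 2 ≤ σ .p) (hp : σ .p < 2 ^ B) (hx : σ .x = 0)
    (ht : σ .t = 0) (hi : σ .i = 0) (hj : σ .j = 0) (hs : σ .s = 0) (hu : σ .u = 0)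
    (hv : σ .v = 0) (hacc : σ .acc = 0) :
    powerSumTest.Maps w B 0 σ
      (decide ((∑ x ∈ Finset.Ico 1 (σ .p), (scanWord (σ .p) x w).2.2) % σ .p = 0)) σ := by
  set f : ℕ → ℕ := fun m => (∑ x ∈ Finset.Ico 1 m, (scanWord (σ .p) x w).2.2) % σ .p with hf
  have hlt (m : ℕ) : f m < σ .p := Nat.mod_lt _ (by omega)
  refine Maps.seq (maps_inc Reg.x (by omega)) (Maps.seq (maps_forLoop
    (fun m => Function.update σ .acc (f m)) (m := 1) (n := σ .p)
    (σ' := Function.update σ .acc (f (σ .p))) ?_ ?_ (by omega) hp (by decide)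
    (fun i _ _ => by simp) ?_)
    (Maps.bind (maps_isZero Reg.acc) (Maps.seq (maps_clear Reg.acc ?_) (maps_pure_of_eq ?_ ?_))))
  · funext k; cases k <;> simp [hx, hacc, hf]
  · funext k; cases k <;> simp [hx]
  · intro m hm hmp
    refine Maps.congr (maps_addSummand ?_ ?_ ?_ ?_ ?_ ?_ ?_ ?_ ?_ ?_) ?_
    · simpa
    · simpa
    · simp; omega
    · simpa
    · simpa
    · simpa
    · simpa
    · simpa
    · simpa
    · simpa using hlt m
    · have : f (m + 1) = (f m + (scanWord (σ .p) m w).2.2) % σ .p := by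
        simp only [hf, Finset.sum_Ico_succ_top hm, Nat.mod_add_mod]
      funext k; cases k <;> simp [this]
  · simpa using (hlt _).trans hp
  · simp [hf]
  · funext k; cases k <;> simp [hacc]

/-! ### The loop of the algorithm -/

/-- The register contents at the head of the while loop. -/
def regs (p c n : ℕ) : Reg → ℕ
  | .p => p
  | .c => c
  | .n => n
  | _ => 0

/-- One passage through the while loop. -/
def loopBody : Frag UnarySymbol Reg Cell (Bool ⊕ Unit) :=
  leTest.cond (powerSumTest.cond (addLog.seq (toNextPrime.seq (pure (.inr ()))))
    (pure (.inl true))) (pure (.inl false))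

/-- If the algorithm continues, the loop body takes the registers from the old to the new values. -/
theorem maps_loopBody_of_loop (I : SubsetSum) {c c' : ℕ} {p p' : Nat.Primes}
    (h : I.algStep (.loop c p) = .loop c' p') (hp : 2 * (p : ℕ) < 2 ^ B) (hc : c + p < 2 ^ B)
    (hn : I.n < 2 ^ B) (hp' : (p' : ℕ) < 2 ^ B) :
    loopBody.Maps I.encode B 0 (regs p c I.n) (.inr ()) (regs p' c' I.n) := by
  obtain ⟨c₁, p₁, hs, hle, h0, rfl, rfl⟩ := I.algStep_eq_loop h
  obtain ⟨rfl, rfl⟩ := AlgState.loop.inj hs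
  have : Fact (p : ℕ).Prime := ⟨p.2⟩
  have h2 := p.2.two_le
  have t1 := maps_leTest (α := UnarySymbol) (w := I.encode) (B := B) (pos := 0)
    (σ := regs p c I.n) (by simp [regs]; omega) (by simpa [regs]) (by omega) rfl rfl
  rw [decide_eq_true (by simpa [regs])] at t1
  have t2 := maps_powerSumTest (w := I.encode) (B := B) (σ := regs p c I.n) h2
    (by simp [regs]; omega) rfl rfl rfl rfl rfl rfl rfl rfl
  rw [decide_eq_true (by simpa [regs] using (sum_scanWord_mod_eq_zero_iff I).2 h0)] at t2
  refine Maps.cond_true t1 (Maps.cond_true t2 (Maps.seq (maps_addLog ?_ ?_ ?_ ?_ ?_ ?_)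
    (Maps.seq (maps_toNextPrime ?_ ?_ ?_ ?_ ?_ ?_) (maps_pure_of_eq rfl ?_))))
  · simp [regs]; omega
  · simpa [regs]
  · simpa [regs]
  · rfl
  · rfl
  · rfl
  · simp [regs]; omega
  · simpa [regs]
  · simp [regs]
  · simp [regs]
  · simp [regs]
  · simp [regs]
  · funext k; cases k <;> simp [regs]

theorem maps_loopBody_of_done (I : SubsetSum) {c : ℕ} {p : Nat.Primes} {b : Bool}
    (h : I.algStep (.loop c p) = .done b) (hp : (p : ℕ) < 2 ^ B) (hc : c < 2 ^ B)
    (hn : I.n < 2 ^ B) :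
    loopBody.Maps I.encode B 0 (regs p c I.n) (.inl b) (regs p c I.n) := by
  have : Fact (p : ℕ).Prime := ⟨p.2⟩
  have h2 := p.2.two_le
  have t1 := maps_leTest (α := UnarySymbol) (w := I.encode) (B := B) (pos := 0)
    (σ := regs p c I.n) (by simpa [regs]) (by simpa [regs]) (by omega) rfl rfl
  simp only [SubsetSum.algStep] at h
  split_ifs at h with h3 h4
  · obtain rfl := AlgState.done.inj h
    rw [decide_eq_true (by simpa [regs])] at t1
    have t2 := maps_powerSumTest (w := I.encode) (B := B) (σ := regs p c I.n) h2
      (by simpa [regs]) rfl rfl rfl rfl rfl rfl rfl rfl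
    rw [decide_eq_false (by simpa [regs] using (sum_scanWord_mod_eq_zero_iff I).not.2 h4)] at t2
    exact Maps.cond_true t1 (Maps.cond_false t2 maps_pure)
  · obtain rfl := AlgState.done.inj h
    rw [decide_eq_false (by simpa [regs] using h3)] at t1
    exact Maps.cond_false t1 maps_pure

end Frag

/-! ### Recognizing encodings -/

/-- The position within the encoding of an integer. -/
inductive Phase where
  /-- before the first letter -/
  | start
  /-- after the minus sign -/
  | minus
  /-- after at least one `one` -/
  | ones
  /-- the word is not a prefix of an encoding -/
  | bad

instance : Finite Phase :=
  Finite.of_injective (fun r => (⟨r.ctorIdx, by cases r <;> decide⟩ : Fin 4)) (by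
    intro r r' h
    cases r <;> cases r' <;> first | rfl | simp [Phase.ctorIdx] at h)

/-- The transition of the finite automaton that recognizes sequences of encodings of integers. -/
def phaseStep : Phase → UnarySymbol → Phase
  | .start, .sep => .start
  | .start, .minus => .minus
  | .start, .one => .ones
  | .minus, .one => .ones
  | .ones, .one => .ones
  | .ones, .sep => .start
  | _, _ => .bad

/-- The phase after reading `w`. -/
def parse (w : List UnarySymbol) : Phase := w.foldl phaseStep .start

theorem parse_append_singleton (w : List UnarySymbol) (a : UnarySymbol) :
    parse (w ++ [a]) = phaseStep (parse w) a := by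
  simp [parse]

theorem foldl_phaseStep_unaryInt (z : ℤ) : (unaryInt z).foldl phaseStep .start = .start := by
  have hones (k : ℕ) : (List.replicate k UnarySymbol.one).foldl phaseStep .ones = .ones := by
    induction k with
    | zero => rfl
    | succ k ih => rw [List.replicate_succ, List.foldl_cons]; exact ih
  rw [unaryInt, List.foldl_append, List.foldl_append]
  by_cases hz : z < 0
  · obtain ⟨k, hk⟩ : ∃ k, z.natAbs = k + 1 := ⟨z.natAbs - 1, by omega⟩
    rw [if_pos hz, hk, List.replicate_succ]
    simp only [List.foldl_cons, List.foldl_nil, phaseStep, hones]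
  · rw [if_neg hz]
    cases z.natAbs with
    | zero => rfl
    | succ k =>
      rw [List.replicate_succ]
      simp only [List.foldl_cons, List.foldl_nil, phaseStep, hones]

theorem parse_flatMap_unaryInt (l : List ℤ) : parse (l.flatMap unaryInt) = .start := by
  induction l with
  | nil => rfl
  | cons z l ih =>
    rw [parse, List.flatMap_cons, List.foldl_append, foldl_phaseStep_unaryInt]
    exact ih

/-- The words that lead to a given phase. -/
def Phase.Word : Phase → List UnarySymbol → Prop
  | .start, w => ∃ l : List ℤ, w = l.flatMap unaryInt
  | .minus, w => ∃ l : List ℤ, w = l.flatMap unaryInt ++ [.minus]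
  | .ones, w => ∃ (l : List ℤ) (b : Bool) (k : ℕ), w = l.flatMap unaryInt ++
      ((if b then [.minus] else []) ++ List.replicate (k + 1) .one)
  | .bad, _ => True

/-- Soundness of the automaton. -/
theorem word_parse (w : List UnarySymbol) : (parse w).Word w := by
  induction w using List.reverseRecOn with
  | nil => exact ⟨[], rfl⟩
  | append_singleton w a ih =>
    rw [parse_append_singleton]
    generalize parse w = ph at ih ⊢
    rcases ph with _ | _ | _ | _
    · obtain ⟨l, rfl⟩ := ih
      rcases a with _ | _ | _
      · exact ⟨l, false, 0, by simp⟩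
      · exact ⟨l, rfl⟩
      · exact ⟨l ++ [0], by simp [unaryInt]⟩
    · obtain ⟨l, rfl⟩ := ih
      rcases a with _ | _ | _
      · exact ⟨l, true, 0, by simp⟩
      · trivial
      · trivial
    · obtain ⟨l, b, k, rfl⟩ := ih
      rcases a with _ | _ | _
      · exact ⟨l, b, k + 1, by simp [List.replicate_succ' (n := k + 1)]⟩
      · trivial
      · refine ⟨l ++ [if b then -(k + 1 : ℤ) else k + 1], ?_⟩
        have h : ¬ ((k : ℤ) + 1 < 0) := by omega
        have h' : -((k : ℤ) + 1) < 0 := by omega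
        have hk : ((k : ℤ) + 1).natAbs = k + 1 := by omega
        have hk' : (-((k : ℤ) + 1)).natAbs = k + 1 := by omega
        cases b
        · simp [unaryInt, h, hk]
        · simp only [if_true, List.flatMap_append, List.flatMap_singleton, unaryInt, if_pos h', hk']
          simp
    · trivial

/-- The encodings are the words that end in phase `start` and contain a separator. -/
theorem exists_encode_eq_iff (w : List UnarySymbol) :
    (∃ I : SubsetSum, I.encode = w) ↔ parse w = .start ∧ w.count .sep ≠ 0 := by
  constructor
  · rintro ⟨I, rfl⟩
    exact ⟨parse_flatMap_unaryInt (I.B :: List.ofFn I.m), by simp [SubsetSum.encode, unaryInt]⟩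
  · rintro ⟨h1, h2⟩
    have := word_parse w
    rw [h1] at this
    obtain ⟨_ | ⟨B, l⟩, rfl⟩ := this
    · simp at h2
    · exact ⟨⟨l.length, l.get, B⟩, by simp [SubsetSum.encode]⟩

theorem count_add_count_le_length (w : List UnarySymbol) :
    w.count .one + w.count .sep ≤ w.length := by
  induction w with
  | nil => simp
  | cons a w ih => cases a <;> simp <;> omega

namespace SubsetSum

variable (I : SubsetSum)

theorem count_one_encode : I.encode.count .one + 1 = I.C := by
  have h (z : ℤ) : (unaryInt z).count .one = z.natAbs := by
    by_cases hz : z < 0 <;> simp [unaryInt, hz]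
  simp [encode, C, h, List.count_flatMap, Function.comp_def, List.map_ofFn, List.sum_ofFn]

theorem count_sep_encode : I.encode.count .sep = I.n + 1 := by
  have h (z : ℤ) : (unaryInt z).count .sep = 1 := by
    by_cases hz : z < 0 <;> simp [unaryInt, hz, List.count_replicate]
  simp [encode, h, List.count_flatMap, Function.comp_def, add_comm]

theorem C_add_n_le : I.C + I.n ≤ I.encode.length := by
  have h1 := count_add_count_le_length I.encode
  have h2 := I.count_one_encode
  have h3 := I.count_sep_encode
  omega

end SubsetSum

namespace Frag

/-- Advance the automaton, and count the letters `one` in register `p` and all separators but the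
first one in register `n`. The flag tells whether no separator has been read yet. -/
def parseBody : Bool × Phase → UnarySymbol → Frag UnarySymbol Reg Cell (Bool × Phase)
  | (f, ph), .one => (inc .p).seq (pure (f, phaseStep ph .one))
  | (f, ph), .minus => pure (f, phaseStep ph .minus)
  | (true, ph), .sep => pure (false, phaseStep ph .sep)
  | (false, ph), .sep => (inc .n).seq (pure (false, phaseStep ph .sep))

theorem runs_parse {w : List UnarySymbol} {B : ℕ} (hB : w.length < 2 ^ B) :
    (forInput parseBody (true, .start)).Maps w B 0 (fun _ => 0)
      (decide (w.count .sep = 0), parse w) (regs (w.count .one) 0 (w.count .sep - 1)) := by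
  have := runs_forInput (w := w) (B := B) (body := parseBody)
    (fun i => (decide ((w.take i).count .sep = 0), parse (w.take i)))
    (fun i => regs ((w.take i).count .one) 0 ((w.take i).count .sep - 1)) (by
      intro i hi
      have hlt : (w.take i).count .one < 2 ^ B ∧ (w.take i).count .sep < 2 ^ B := by
        have := count_add_count_le_length (w.take i)
        rw [List.length_take] at this
        omega
      simp only [List.take_succ_eq_append_getElem hi, parse_append_singleton, List.count_append]
      generalize w[i] = a
      cases a with
      | one =>
        refine Maps.seq (maps_inc Reg.p (by simpa [regs] using hlt.1)) (maps_pure_of_eq ?_ ?_)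
        · simp
        · funext k; cases k <;> simp [regs]
      | minus =>
        refine maps_pure_of_eq ?_ ?_
        · simp
        · simp
      | sep =>
        by_cases h0 : (w.take i).count .sep = 0
        · simp only [h0, decide_true]
          refine maps_pure_of_eq ?_ ?_
          · simp
          · simp
        · simp only [h0, decide_false]
          refine Maps.seq (maps_inc Reg.n (by simp [regs]; omega)) (maps_pure_of_eq ?_ ?_)
          · simp
          · have : List.count .sep (w.take i) - 1 + 1 = List.count .sep (w.take i) := by omega
            funext k; cases k <;> simp [regs, this])
  rw [List.take_length] at this
  convert this using 1
  · rfl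
  · funext k; cases k <;> rfl

/-- Check the format of the input; if it is an encoding, initialize the registers. -/
def setup : Frag UnarySymbol Reg Cell Bool :=
  mark.seq <| (forInput parseBody (true, .start)).bind fun
    | (false, .start) => (inc .p).seq (toNextPrime.seq (pure true))
    | _ => pure false

/-- The memory with blank work tapes. -/
def blankMemory : Memory Reg Cell where
  inputPos := 0
  tape := fun _ _ => (false, none)
  head := fun _ => 0

/-- On the encoding of an instance, the registers get the initial values `p = NextPrime C` and
`c = 0`. -/
theorem runs_setup_encode (I : SubsetSum) {B : ℕ} (hB : I.encode.length < 2 ^ B)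
    (hp : (nextPrime I.C : ℕ) < 2 ^ B) :
    setup.Runs I.encode (B + 1) blankMemory true (store (regs (nextPrime I.C) 0 I.n) 0) := by
  have h1 := runs_parse hB
  rw [I.count_sep_encode, ((exists_encode_eq_iff _).1 ⟨I, rfl⟩).1, decide_eq_false (by omega)] at h1
  refine Runs.seq (runs_mark (Nat.succ_pos _)) (Maps.bind h1 (Maps.seq (maps_inc Reg.p ?_)
    (Maps.seq (maps_toNextPrime ?_ ?_ ?_ ?_ ?_ ?_) (maps_pure_of_eq rfl ?_))))
  · have := I.count_one_encode
    have := I.C_add_n_le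
    simp [regs]
    omega
  · simp
  · simpa [regs, I.count_one_encode]
  · simp [regs]
  · simp [regs]
  · simp [regs]
  · simp [regs]
  · funext k; cases k <;> simp [regs, I.count_one_encode]

theorem runs_setup_of_ne {w : List UnarySymbol} (hw : ¬ ∃ I : SubsetSum, I.encode = w) {B : ℕ}
    (hB : w.length < 2 ^ B) :
    setup.Runs w (B + 1) blankMemory false
      (store (regs (w.count .one) 0 (w.count .sep - 1)) 0) := by
  refine Runs.seq (runs_mark (Nat.succ_pos _)) (Maps.bind (runs_parse hB) ?_)
  rw [exists_encode_eq_iff] at hw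
  split
  · rename_i h
    simp only [Prod.mk.injEq, decide_eq_false_iff_not] at h
    exact absurd ⟨h.2, h.1⟩ hw
  · exact maps_pure

/-- Execute the while loop on valid inputs, and reject the others. -/
def mainLoop : Bool → Frag UnarySymbol Reg Cell Bool
  | true => iter (fun _ : Unit => loopBody) ()
  | false => pure false

/-- The algorithm, with all its variables in binary registers. -/
def algorithm : Frag UnarySymbol Reg Cell Bool := setup.bind mainLoop

/-- The control state at the head of the while loop. -/
def loopHead : algorithm.Q :=
  Sum.inr (⟨true, (mainLoop true).entry⟩ : Σ b, (mainLoop b).Q)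

theorem path_setup {w : List UnarySymbol} {V : ℕ} {D D' : Memory Reg Cell}
    (h : setup.Runs w V D true D') :
    algorithm.Path w V (.inl algorithm.entry, D) (.inl loopHead, D') :=
  path_bind_left h

theorem path_loop {w : List UnarySymbol} {V : ℕ} {D D' : Memory Reg Cell}
    (h : loopBody.Runs w V D (.inr ()) D') :
    algorithm.Path w V (.inl loopHead, D) (.inl loopHead, D') :=
  path_bind_right (G := mainLoop) (e := true) (x := .inl (mainLoop true).entry)
    (path_iter (F := fun _ : Unit => loopBody) (s := ()) (s₀ := ()) h)

theorem path_exit {w : List UnarySymbol} {V : ℕ} {D D' : Memory Reg Cell} {b : Bool}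
    (h : loopBody.Runs w V D (.inl b) D') :
    algorithm.Path w V (.inl loopHead, D) (.inr b, D') :=
  path_bind_right (G := mainLoop) (e := true) (x := .inr b)
    (path_iter (F := fun _ : Unit => loopBody) (s := ()) (s₀ := ()) h)

end Frag

/-! ### The machine -/

/-- The machine that carries out the algorithm. -/
def subsetSumTM : OfflineTM UnarySymbol := Frag.algorithm.toTM (false, none)

namespace subsetSumTM

/-- The configuration of the machine with given control state and memory. -/
abbrev cfg (x : (Frag.algorithm.Q ⊕ Bool) × Memory Reg Cell) : subsetSumTM.Cfg :=
  Frag.algorithm.toCfg (false, none) x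

/-- Up to time `t` the work heads have stayed at positions below `V`. -/
def SpaceUpTo (w : List UnarySymbol) (V t : ℕ) : Prop :=
  ∀ t' ≤ t, ∀ k, (subsetSumTM.run w t').head k < V

/-- A path of the fragment, appended to a run of the machine. -/
theorem exists_run_eq {w : List UnarySymbol} {V t : ℕ} {x y} (hx : subsetSumTM.run w t = cfg x)
    (ht : SpaceUpTo w V t) (h : Frag.algorithm.Path w V x y) (hy : ∀ k, y.2.head k < V) :
    ∃ t' > t, subsetSumTM.run w t' = cfg y ∧ SpaceUpTo w V t' := by
  obtain ⟨u, hu, he, hb⟩ := h.exists_iterate (blank := (false, none))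
  have hadd (u : ℕ) : subsetSumTM.run w (t + u) = (subsetSumTM.step w)^[u] (cfg x) := by
    rw [OfflineTM.run_add, hx]
  refine ⟨t + u, by omega, (hadd u).trans he, fun t' ht' k => ?_⟩
  rcases le_or_gt t' t with h1 | h1
  · exact ht t' h1 k
  obtain ⟨u', rfl⟩ : ∃ u', t' = t + u' := ⟨t' - t, by omega⟩
  rw [hadd]
  rcases (show u' ≤ u by omega).lt_or_eq with h2 | rfl
  · exact hb u' h2 k
  · have := hy k
    rw [show (subsetSumTM.step w)^[u'] (cfg x) = cfg y from he]
    exact this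

theorem spaceUpTo_zero (w : List UnarySymbol) (V : ℕ) : SpaceUpTo w (V + 1) 0 := by
  intro t ht k
  obtain rfl : t = 0 := by omega
  exact Nat.succ_pos _

/-- A number of binary digits that is enough for all registers on inputs of length `N`. -/
def digitBound (N : ℕ) : ℕ := Nat.log 2 (4 * (N + 2) ^ 6) + 1

theorem lt_two_pow_digitBound (N : ℕ) : 4 * (N + 2) ^ 6 < 2 ^ digitBound N :=
  Nat.lt_pow_succ_log_self (by norm_num) _

theorem self_lt_two_pow_digitBound (N : ℕ) : N < 2 ^ digitBound N := by
  have := lt_two_pow_digitBound N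
  have := Nat.le_self_pow (show 6 ≠ 0 by norm_num) (N + 2)
  omega

theorem bounds {I : SubsetSum} {j c : ℕ} {p : Nat.Primes} (h : I.algRun j = .loop c p) :
    2 * (p : ℕ) < 2 ^ digitBound I.encode.length ∧ c + p < 2 ^ digitBound I.encode.length ∧
      I.n < 2 ^ digitBound I.encode.length := by
  have h1 := I.prime_le_pow h
  have h2 := I.C_add_n_le
  have h3 := (I.loopInvariant h).le
  have h4 := lt_two_pow_digitBound I.encode.length
  have h5 : (I.C + I.n + 1) ^ 6 ≤ (I.encode.length + 2) ^ 6 := by gcongr; omega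
  have h6 := Nat.le_self_pow (show 6 ≠ 0 by norm_num) (I.encode.length + 2)
  refine ⟨by omega, by omega, by omega⟩

/-- At time `t` the machine is in a configuration that represents the state `s` of the algorithm. -/
def Reached (I : SubsetSum) (s : AlgState) (t : ℕ) : Prop :=
  match s with
  | .loop c p => subsetSumTM.run I.encode t =
      cfg (.inl Frag.loopHead, store (Frag.regs p c I.n) 0)
  | .done b => subsetSumTM.verdict (subsetSumTM.run I.encode t).state = some b

theorem exists_reached_zero (I : SubsetSum) : ∃ t, Reached I (I.algRun 0) t ∧
    SpaceUpTo I.encode (digitBound I.encode.length + 1) t := by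
  have hb := bounds (show I.algRun 0 = .loop 0 (nextPrime I.C) from rfl)
  obtain ⟨t, -, h1, h2⟩ := exists_run_eq (x := (.inl Frag.algorithm.entry, Frag.blankMemory)) rfl
    (spaceUpTo_zero _ _) (Frag.path_setup (Frag.runs_setup_encode I
      (self_lt_two_pow_digitBound I.encode.length) (by omega))) (fun _ => Nat.succ_pos _)
  exact ⟨t, h1, h2⟩

theorem exists_reached_succ {I : SubsetSum} {j t : ℕ} (h : Reached I (I.algRun j) t)
    (ht : SpaceUpTo I.encode (digitBound I.encode.length + 1) t) :
    ∃ t' > t, Reached I (I.algRun (j + 1)) t' ∧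
      SpaceUpTo I.encode (digitBound I.encode.length + 1) t' := by
  have hsucc := I.algRun_succ j
  cases hs : I.algRun j with
  | done b =>
    rw [hs] at hsucc h
    have hrun := subsetSumTM.run_of_halted I.encode h 1
    refine ⟨t + 1, by omega, ?_, fun t' ht' k => ?_⟩
    · rw [hsucc]
      simp only [SubsetSum.algStep, Reached, hrun]
      exact h
    · rcases (show t' ≤ t ∨ t' = t + 1 by omega) with h1 | rfl
      · exact ht t' h1 k
      · rw [hrun]
        exact ht t le_rfl k
  | loop c p =>
    rw [hs] at hsucc h
    have hb := bounds hs
    cases hs' : I.algRun (j + 1) with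
    | done b =>
      rw [hs'] at hsucc
      obtain ⟨t', h1, h2, h3⟩ := exists_run_eq h ht (Frag.path_exit
        (Frag.maps_loopBody_of_done I hsucc.symm (by omega) (by omega) hb.2.2))
        (fun _ => Nat.succ_pos _)
      exact ⟨t', h1, by rw [Reached, h2]; rfl, h3⟩
    | loop c' p' =>
      have hb' := bounds hs'
      rw [hs'] at hsucc
      obtain ⟨t', h1, h2, h3⟩ := exists_run_eq h ht (Frag.path_loop
        (Frag.maps_loopBody_of_loop I hsucc.symm hb.1 hb.2.1 hb.2.2 (by omega)))
        (fun _ => Nat.succ_pos _)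
      exact ⟨t', h1, h2, h3⟩

/-- The machine represents the successive states of the algorithm at successive times, and its heads
stay within the space bound until each of these times. -/
theorem exists_reached (I : SubsetSum) : ∃ τ : ℕ → ℕ, StrictMono τ ∧
    ∀ j, Reached I (I.algRun j) (τ j) ∧
      SpaceUpTo I.encode (digitBound I.encode.length + 1) (τ j) := by
  let P (j t : ℕ) : Prop := Reached I (I.algRun j) t ∧
    SpaceUpTo I.encode (digitBound I.encode.length + 1) t
  obtain ⟨t₀, h₀⟩ : ∃ t, P 0 t := exists_reached_zero I
  have hstep (j : ℕ) (t : {t // P j t}) : ∃ t' : {t // P (j + 1) t}, t.1 < t'.1 := by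
    obtain ⟨t', h1, h2⟩ := exists_reached_succ t.2.1 t.2.2
    exact ⟨⟨t', h2⟩, h1⟩
  choose f hf using hstep
  let τ (j : ℕ) : {t // P j t} := Nat.rec ⟨t₀, h₀⟩ f j
  exact ⟨fun j => (τ j).1, strictMono_nat_of_lt_succ fun j => hf j (τ j), fun j => (τ j).2⟩

/-- On every encoding the machine halts with the answer of the algorithm. -/
theorem exists_halted_encode {I : SubsetSum} {b : Bool} (h : I.AlgReturns b) :
    ∃ t, subsetSumTM.verdict (subsetSumTM.run I.encode t).state = some b ∧
      SpaceUpTo I.encode (digitBound I.encode.length + 1) t := by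
  obtain ⟨j, hj⟩ := h
  obtain ⟨τ, -, hτ⟩ := exists_reached I
  obtain ⟨h1, h2⟩ := hτ j
  rw [hj] at h1
  exact ⟨τ j, h1, h2⟩

theorem exists_halted_of_ne {w : List UnarySymbol} (hw : ¬ ∃ I : SubsetSum, I.encode = w) :
    ∃ t, subsetSumTM.verdict (subsetSumTM.run w t).state = some false ∧
      SpaceUpTo w (digitBound w.length + 1) t := by
  obtain ⟨t, -, h1, h2⟩ := exists_run_eq (x := (.inl Frag.algorithm.entry, Frag.blankMemory)) rfl
    (spaceUpTo_zero _ _) ((Frag.runs_setup_of_ne hw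
      (self_lt_two_pow_digitBound w.length)).bind Frag.runs_pure_store)
    (fun _ => Nat.succ_pos _)
  exact ⟨t, by rw [h1]; rfl, h2⟩

theorem decides : subsetSumTM.Decides unarySubsetSum := by
  intro w
  constructor
  · rintro ⟨I, rfl, hI⟩
    obtain ⟨t, ht, -⟩ := exists_halted_encode ((I.algReturns_iff true).2 (by simpa using hI))
    exact ⟨t, ht⟩
  · intro hw
    by_cases h : ∃ I : SubsetSum, I.encode = w
    · obtain ⟨I, rfl⟩ := h
      have hI : ¬ I.Solvable := fun hI => hw ⟨I, rfl, hI⟩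
      obtain ⟨t, ht, -⟩ := exists_halted_encode ((I.algReturns_iff false).2 (by simpa using hI))
      exact ⟨t, ht⟩
    · obtain ⟨t, ht, -⟩ := exists_halted_of_ne h
      exact ⟨t, ht⟩

theorem runsInSpace : subsetSumTM.RunsInSpace fun N => digitBound N + 1 := by
  intro w t k
  obtain ⟨T, b, hT, hs⟩ : ∃ T b, subsetSumTM.verdict (subsetSumTM.run w T).state = some b ∧
      SpaceUpTo w (digitBound w.length + 1) T := by
    by_cases h : ∃ I : SubsetSum, I.encode = w
    · obtain ⟨I, rfl⟩ := h
      obtain ⟨b, hb⟩ := I.exists_algReturns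
      obtain ⟨T, h⟩ := exists_halted_encode hb
      exact ⟨T, b, h⟩
    · obtain ⟨T, h⟩ := exists_halted_of_ne h
      exact ⟨T, false, h⟩
  rcases le_total t T with h | h
  · exact hs t h k
  · obtain ⟨u, rfl⟩ := Nat.exists_eq_add_of_le h
    rw [subsetSumTM.run_of_halted w hT]
    exact hs T le_rfl k

theorem isBigO_digitBound :
    (fun N => ((digitBound N + 1 : ℕ) : ℝ)) =O[atTop] fun N => Real.log (N : ℝ) := by
  refine Asymptotics.IsBigO.of_bound (15 / Real.log 2) ?_
  -- for `N ≥ 4`, both `4 ≤ N` and `N + 2 ≤ N ^ 2`, so `4 * (N + 2) ^ 6 ≤ N ^ 13`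
  filter_upwards [eventually_ge_atTop 4] with N hN
  have hlog2 : 0 < Real.log 2 := Real.log_pos (by norm_num)
  have hle : 4 * (N + 2) ^ 6 ≤ N ^ 13 := by
    calc 4 * (N + 2) ^ 6 ≤ N * (N ^ 2) ^ 6 := by
          gcongr
          nlinarith
      _ = N ^ 13 := by ring
  have hpow : (2 : ℝ) ^ Nat.log 2 (4 * (N + 2) ^ 6) ≤ (N : ℝ) ^ 13 := by
    exact_mod_cast (Nat.pow_log_le_self 2 (by positivity)).trans hle
  have h1 := Real.log_le_log (by positivity) hpow
  rw [Real.log_pow, Real.log_pow] at h1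
  have h2 : Real.log 2 ≤ Real.log N / 2 := by
    have h3 : Real.log ((2 : ℝ) ^ 2) ≤ Real.log N :=
      Real.log_le_log (by norm_num) (by norm_num; exact_mod_cast hN)
    rw [Real.log_pow] at h3
    push_cast at h3
    linarith
  have h4 : 0 ≤ Real.log N := by linarith
  rw [Real.norm_of_nonneg (by positivity), Real.norm_of_nonneg h4, div_mul_eq_mul_div,
    le_div_iff₀ hlog2, digitBound]
  push_cast at h1 ⊢
  linarith

theorem runsInLogspace : subsetSumTM.RunsInLogspace :=
  ⟨_, isBigO_digitBound, runsInSpace⟩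

theorem carriesOutAlg : subsetSumTM.CarriesOutAlg := by
  refine ⟨.inl Frag.loopHead, Reg.p, Reg.c, fun g : Cell => g.2 == some true, fun I => ?_⟩
  obtain ⟨τ, hτ, h⟩ := exists_reached I
  refine ⟨τ, hτ, fun j => ?_⟩
  have h1 := (h j).1
  cases hs : I.algRun j with
  | done b =>
    rw [hs] at h1
    exact h1
  | loop c p =>
    rw [hs, Reached] at h1
    rw [h1]
    exact ⟨rfl, digit_beq_some_true p, digit_beq_some_true c⟩

end subsetSumTM

theorem mainTheorem1 :
    -- Unary Subset-Sum is in deterministic logspace.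
    unarySubsetSum ∈ LOGSPACE UnarySymbol ∧
    -- The algorithm itself is carried out by a logspace machine deciding the problem.
    (∃ M : OfflineTM UnarySymbol,
      M.RunsInLogspace ∧ M.Decides unarySubsetSum ∧ M.CarriesOutAlg) ∧
    -- The algorithm always terminates with the correct answer.
    (∀ I : SubsetSum, (I.AlgReturns true ↔ I.Solvable) ∧ (I.AlgReturns false ↔ ¬ I.Solvable)) ∧
    -- The product of the checked primes divides `A`, and exceeds `2 ^ n ≥ A` once `c > n`.
    (∀ I : SubsetSum, I.numSolutions ≤ 2 ^ I.n ∧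
      ∀ (j c : ℕ) (p : Nat.Primes), I.algRun j = .loop c p →
        I.checkedProduct p ∣ I.numSolutions ∧ (I.n < c → 2 ^ I.n < I.checkedProduct p)) ∧
    -- Enough primes lie between `C` and a polynomial in `C` and `n`.
    (∃ d : ℕ, ∀ C n : ℕ, 1 ≤ C →
      n ≤ ((Finset.Icc C ((C + n + 1) ^ d)).filter Nat.Prime).card) ∧
    -- All primes reached by the algorithm are polynomially bounded.
    (∃ d : ℕ, ∀ (I : SubsetSum) (j c : ℕ) (p : Nat.Primes), I.algRun j = .loop c p →
      (p : ℕ) ≤ (I.C + I.n + 1) ^ d) := by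
  refine ⟨⟨subsetSumTM, subsetSumTM.runsInLogspace, subsetSumTM.decides⟩,
    ⟨subsetSumTM, subsetSumTM.runsInLogspace, subsetSumTM.decides, subsetSumTM.carriesOutAlg⟩,
    fun I => ⟨?_, ?_⟩, fun I => ⟨I.numSolutions_le, fun j c p h =>
      ⟨(I.loopInvariant h).dvd, I.two_pow_lt_checkedProduct h⟩⟩,
    ⟨6, fun C n hC => le_card_primes_Icc hC⟩, ⟨6, fun I j c p h => I.prime_le_pow h⟩⟩
  · simpa using I.algReturns_iff true
  · simpa using I.algReturns_iff false
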